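/- **Conventions.** Let $X=\{0,1\}$, let $X^\omega$ be the Cantor set of infinite words over $X$, and let $\sigma$ be the shift $\sigma(x_1x_2x_3\ldots)=x_2x_3\ldots$. Thompson's group $F$ acts on $X^\omega$ in the standard way: it is generated by $$x_0:\ 0z\mapsto 00z,\quad 10z\mapsto 01z,\quad 11z\mapsto 1z;\qquad x_1:\ 0z\mapsto 0z,\quad 10z\mapsto 100z,\quad 110z\mapsto 101z,\quad 111z\mapsto 11z .$$ The Schreier graph $\Gamma_x$ of $x\in X^\omega$ has the orbit of $x$ under $F$ as its vertex set (each vertex is labeled by itself), an arrow labeled $s\in\{x_0,x_1\}$ from $a$ to $b$ if and only if $s$ sends $a$ to $b$, and base vertex $x$. Vertices $0z$, $10z$, $11z$ are called black, grey and white. A *start* is a word $1^n0$ or $0^m1$ with $n,m\ge 1$. A point of $X^\omega$ is rational if it is eventually periodic. $\Gamma=\Gamma_{10^\infty}$ denotes the Schreier graph of $\frac12$; its vertices are written without the trailing zeros. *Graphs with a spine.* Start with a spine of grey vertices, which is either an infinite path $g_0,g_1,g_2,\ldots$ going up or a cycle, where each step up from a spine vertex to the next one carries a letter; the lower vertex is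 then the child of that type of the upper one. Attach binary trees of grey vertices going down so that every grey vertex has exactly one child of type $0$ and one child of type $1$ (on the spine one of these may be the spine vertex below). To each grey vertex $c$ attach black vertices $b_1,b_2,\ldots$ and white vertices $c_2,c_3,\ldots$ (put $c_1=c$), with arrows $x_0: c\to b_1$, $b_m\to b_{m+1}$, $c_{n+1}\to c_n$ $(m,n\ge1)$, and $x_1: b_m\to b_m$, $c_{n+1}\to c_n$ $(n\ge 2)$, $c\to$ (child of type $0$), $c_2\to$ (child of type $1$). A step up with letter $0$ *turns left* (an arrow $x_1$ from the upper to the lower vertex); a step up with letter $1$ *turns right* (a white vertex with arrows $x_0$ to the upper and $x_1$ to the lower vertex). If a spine vertex is labeled $10z$, then the grey vertex obtained from it by going down along a finite word $p$, read from its last letter to its first, is labeled $10pz$, and the vertices $b_m$, $c_n$ attached to it are labeled $0^m1pz$, $1^n0pz$. For $u\in X^\omega$ and a start $a$, the graph $\tilde\Gamma_{au}$ of type B is the graph whose spine is the infinite path with $k$-th step up ($k\ge1$) carrying the $k$-th letter of $u$, with $g_k$ labeled $10\sigma^k(u)$; its base vertex is the vertex with label $au$ at $g_0$. *Trees.* In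 $\Gamma_x$, the tree hanging down from a grey vertex $10u$ consists of all vertices $b\,p\,u$, $b$ a start and $p\in X^*$. The tree hanging down and to the left at the white vertex $110z$ consists of the vertices $1^n0z$, $n\ge2$, and the tree hanging down from $101z$; its root is $110z$. The tree hanging down and to the right at the grey vertex $10z$ is the tree hanging down from its child $100z$, which is its root. **Theorem.** Let $x\in X^\omega$ be rational, $x\ne 0^\infty,1^\infty$. Then $x$ can be uniquely written as $x=1^n0vw^\infty$ with $n\ge1$ or $x=0^m1vw^\infty$ with $m\ge1$, where $v,w\in X^*$, $w$ is nonempty and not a proper power, and $v$ is empty or its last letter differs from the last letter of $w$. For this $v,w$: (a) Gluing all vertices of $\tilde\Gamma_x$ with equal labels gives $\Gamma_x$, by an isomorphism of marked pointed graphs that preserves labels. (b) Explicitly, $\Gamma_x$ is isomorphic, with labels, to the graph whose spine is a cycle of $|w|$ grey vertices $10\sigma^i(w^\infty)$, $0\le i<|w|$, in which the step up from $10\sigma^i(w^\infty)$ to $10\sigma^{i+1}(w^\infty)$ carries the $(i+1)$-st letter of $w$; the base vertex sits at the grey vertex reached from $10w^\infty$ by going down along $v$. (c) For each vertex $10u$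 with $u\neq\sigma^i(w^\infty)$ for all $i$, the tree hanging down from $10u$ is attached to the rest of $\Gamma_x$ only at $10u$, and $b\,p\,u\mapsto b\,p\,10^\infty$ is a well-defined isomorphism of it onto the tree hanging down at the vertex $101$ in $\Gamma$. (d) The path $10vw^\infty,\ 10\sigma(vw^\infty),\ldots,\ 10\sigma^{|v|+|w|-1}(vw^\infty)=10\sigma^{|w|-1}(w^\infty)$ of grey vertices goes up, turns left or right at its $k$-th step if the $k$-th letter of $vw$ is $0$ or $1$ respectively, and its grey vertices are distinct. (e) If the last letter of $w$ is $0$, there is an arrow labeled $x_1$ from $10w^\infty$ to $10\sigma^{|w|-1}(w^\infty)$. (f) If the last letter of $w$ is $1$, the vertex $110w^\infty$ has arrows labeled $x_0$ to $10w^\infty$ and $x_1$ to $10\sigma^{|w|-1}(w^\infty)$. (g) The part of the path in (d) from $10w^\infty$ on (with the white vertices on it), closed up by (e) or (f), is a loop without repeated vertices, the *nontrivial loop*. It has exactly $|w|$ grey vertices. (For $|w|=1$ it is degenerate: one grey vertex with a loop $x_1$, or a grey and a white vertex joined by two arrows.) (h) Let $10z$ be a grey vertex of the nontrivial loop and $y$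 a vertex adjacent to it that is not on the loop. Then $y$ is one of the following, and the ray or tree in question is attached to the rest of $\Gamma_x$ only at $y$: the vertex $01z$, which is the beginning of the geodesic $01z,001z,0001z,\ldots$, isomorphic as a marked graph to the geodesic $1,01,001,\ldots$ in $\Gamma$; or the vertex $110z$, which is the root of the tree hanging down and to the left at $110z$, isomorphic as a rooted marked graph to the tree hanging down and to the left at the vertex $11$ in $\Gamma$; or the vertex $100z$, which is the root of the tree hanging down from it, isomorphic as a rooted marked graph to the tree hanging down and to the right at the vertex $101$ in $\Gamma$. -/

import Mathlib

/-! ### The Cantor set and the standard action of Thompson's group -/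

/-- The Cantor set `X^ω` of infinite words over the alphabet `X = {0, 1}`. The shift `σ` iterated
`k` times is `Stream'.drop k`; the concatenation of a finite word `p` with an infinite word `z`
is `p ++ₛ z`. -/
abbrev Cantor : Type := Stream' (Fin 2)

/-- The constant words `000…` and `111…`. -/
abbrev constWord (a : Fin 2) : Cantor := Stream'.const a

/-- The periodic word `w^∞ = www…` (meaningful for nonempty `w`). -/
def periodic (w : List (Fin 2)) : Cantor := fun n => w.getD (n % w.length) 0

/-- Rational elements of the Cantor set: the preperiodic sequences. -/
def IsRational (x : Cantor) : Prop := ∃ k p : ℕ, 0 < p ∧ x.drop (k + p) = x.drop k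

/-- The map `0w ↦ 00w`, `10w ↦ 01w`, `11w ↦ 1w`. -/
def x0Fun (z : Cantor) : Cantor :=
  if z.get 0 = 0 then [0, 0] ++ₛ z.drop 1
  else if z.get 1 = 0 then [0, 1] ++ₛ z.drop 2
  else [1] ++ₛ z.drop 2

/-- The inverse map `00w ↦ 0w`, `01w ↦ 10w`, `1w ↦ 11w`. -/
def x0Inv (z : Cantor) : Cantor :=
  if z.get 0 = 1 then [1, 1] ++ₛ z.drop 1
  else if z.get 1 = 0 then [0] ++ₛ z.drop 2
  else [1, 0] ++ₛ z.drop 2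

/-- The map `0w ↦ 0w`, `10w ↦ 100w`, `110w ↦ 101w`, `111w ↦ 11w`; that is, it fixes `0w` and sends
`1w` to `1 x₀(w)`. -/
def x1Fun (z : Cantor) : Cantor :=
  if z.get 0 = 0 then z
  else if z.get 1 = 0 then [1, 0, 0] ++ₛ z.drop 2
  else if z.get 2 = 0 then [1, 0, 1] ++ₛ z.drop 3
  else [1, 1] ++ₛ z.drop 3

/-- The inverse map `0w ↦ 0w`, `100w ↦ 10w`, `101w ↦ 110w`, `11w ↦ 111w`. -/
def x1Inv (z : Cantor) : Cantor :=
  if z.get 0 = 0 then z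
  else if z.get 1 = 1 then [1, 1, 1] ++ₛ z.drop 2
  else if z.get 2 = 0 then [1, 0] ++ₛ z.drop 3
  else [1, 1, 0] ++ₛ z.drop 3

theorem exists_eq_append (z : Cantor) :
    ∃ a b c : Fin 2, ∃ t : Cantor, z = [a, b, c] ++ₛ t :=
  ⟨z.get 0, z.get 1, z.get 2, z.drop 3, by
    funext n
    match n with
    | 0 => rfl
    | 1 => rfl
    | 2 => rfl
    | n + 3 => rfl⟩

/-- The generator `x₀` as a bijection of the Cantor set. -/
def x0Perm : Equiv.Perm Cantor where
  toFun := x0Fun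
  invFun := x0Inv
  left_inv z := by
    obtain ⟨a, b, c, t, rfl⟩ := exists_eq_append z
    fin_cases a <;> fin_cases b <;> fin_cases c <;> rfl
  right_inv z := by
    obtain ⟨a, b, c, t, rfl⟩ := exists_eq_append z
    fin_cases a <;> fin_cases b <;> fin_cases c <;> rfl

/-- The generator `x₁` as a bijection of the Cantor set. -/
def x1Perm : Equiv.Perm Cantor where
  toFun := x1Fun
  invFun := x1Inv
  left_inv z := by
    obtain ⟨a, b, c, t, rfl⟩ := exists_eq_append z
    fin_cases a <;> fin_cases b <;> fin_cases c <;> rfl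
  right_inv z := by
    obtain ⟨a, b, c, t, rfl⟩ := exists_eq_append z
    fin_cases a <;> fin_cases b <;> fin_cases c <;> rfl

/-- Names of the two generators. -/
inductive Gen
  | x0
  | x1

/-- The bijection of the Cantor set given by a generator. -/
def Gen.perm : Gen → Equiv.Perm Cantor
  | .x0 => x0Perm
  | .x1 => x1Perm

/-- Thompson's group `F` in its standard (faithful) action on the Cantor set: the group of
bijections of `X^ω` generated by `x₀` and `x₁`. -/
def thompsonF : Subgroup (Equiv.Perm Cantor) := Subgroup.closure (Set.range Gen.perm)

/-- The generating set `{x₀, x₁}` of `F`. -/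
def Gen.elt (s : Gen) : thompsonF := ⟨s.perm, Subgroup.subset_closure ⟨s, rfl⟩⟩

/-! ### Marked graphs and Schreier graphs -/

/-- An oriented graph on `V` with arrows labelled by generators: `edge s a b` means that there is
an arrow labelled `s` from `a` to `b`. -/
structure MarkedGraph (V : Type) where
  edge : Gen → V → V → Prop

namespace MarkedGraph

/-- Isomorphisms of marked graphs. -/
structure Iso {V W : Type} (Γ : MarkedGraph V) (Δ : MarkedGraph W) extends V ≃ W where
  edge_iff : ∀ (s : Gen) (a b : V), Δ.edge s (toFun a) (toFun b) ↔ Γ.edge s a b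

/-- The marked subgraph induced on a set of vertices. -/
def induce {V : Type} (Γ : MarkedGraph V) (S : Set V) : MarkedGraph S where
  edge s a b := Γ.edge s a b

/-- The marked graph obtained by gluing all vertices on which `label` takes the same value. -/
def glue {V L : Type} (Γ : MarkedGraph V) (label : V → L) :
    MarkedGraph (Quotient (Setoid.ker label)) where
  edge s A B := ∃ a b : V, Quotient.mk _ a = A ∧ Quotient.mk _ b = B ∧ Γ.edge s a b

/-- Two vertices are adjacent if some arrow joins them, in one direction or the other. -/
def Adj {V : Type} (Γ : MarkedGraph V) (a b : V) : Prop := ∃ s, Γ.edge s a b ∨ Γ.edge s b a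

/-- The underlying simple graph (forgetting labels, directions, multiplicities and loops). -/
def toSimpleGraph {V : Type} (Γ : MarkedGraph V) : SimpleGraph V := SimpleGraph.fromRel Γ.Adj

/-- A one-sided infinite geodesic `r 0, r 1, r 2, …`. -/
def IsGeodesicRay {V : Type} (Γ : MarkedGraph V) (r : ℕ → V) : Prop :=
  (∀ m, Γ.Adj (r m) (r (m + 1))) ∧ ∀ m k, Γ.toSimpleGraph.dist (r m) (r (m + k)) = k

/-- The part of `Γ` on the vertex set `S` is attached to the rest of `Γ` only at its root `r`:
every arrow between `S` and its complement has `r` as its end in `S`. -/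
def HangsAt {V : Type} (Γ : MarkedGraph V) (S : Set V) (r : V) : Prop :=
  r ∈ S ∧ ∀ s a b, Γ.edge s a b → (a ∈ S → b ∉ S → a = r) ∧ (a ∉ S → b ∈ S → b = r)

/-- The induced subgraphs of `Γ` on `S` with root `r` and of `Δ` on `T` with root `t` are
isomorphic as rooted marked graphs. -/
def RootedIso {V W : Type} (Γ : MarkedGraph V) (S : Set V) (r : V)
    (Δ : MarkedGraph W) (T : Set W) (t : W) : Prop :=
  ∃ (hr : r ∈ S) (ht : t ∈ T) (φ : (Γ.induce S).Iso (Δ.induce T)), φ.toEquiv ⟨r, hr⟩ = ⟨t, ht⟩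

end MarkedGraph

/-- The vertex set of the Schreier graph of `x`: the orbit of `x` under `F`. The label of a vertex
is the vertex itself, as an element of the Cantor set. -/
abbrev Orb (x : Cantor) : Type := MulAction.orbit thompsonF x

/-- The base vertex of the Schreier graph of `x`. -/
def basePt (x : Cantor) : Orb x := ⟨x, MulAction.mem_orbit_self x⟩

/-- The orbital Schreier graph of a set with an action of `F`, with respect to `{x₀, x₁}`: there is
an arrow labelled `s` from `a` to `b` if and only if `s` sends `a` to `b`. -/
def orbitalGraph (M : Type) [MulAction thompsonF M] : MarkedGraph M where
  edge s a b := s.elt • a = b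

/-- The Schreier graph `Γ_x` of the action of `F` on the orbit of `x`. -/
def schreier (x : Cantor) : MarkedGraph (Orb x) := orbitalGraph (Orb x)

/-! ### Normal forms -/

/-- The beginnings `0^m 1` and `1^n 0` with `m, n ≥ 1` of nonconstant infinite words:
`black m` stands for `0^(m+1) 1` and `white n` stands for `1^(n+1) 0`. The words with beginning
`white 0 = 10` are the labels of grey vertices. -/
inductive Start
  | black (m : ℕ)
  | white (n : ℕ)

/-- The finite word denoted by a beginning. -/
def Start.word : Start → List (Fin 2)
  | .black m => List.replicate (m + 1) 0 ++ [1]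
  | .white n => List.replicate (n + 1) 1 ++ [0]

/-- A finite word is primitive if it is nonempty and not a proper power. -/
def IsPrimitive (w : List (Fin 2)) : Prop :=
  w ≠ [] ∧ ∀ (u : List (Fin 2)) (n : ℕ), w = (List.replicate n u).flatten → n = 1

/-- `x = a v w^∞` where `a` is `1^n 0` or `0^m 1` (with `m, n ≥ 1`), `w` is primitive, and `v` does
not end with the last letter of `w` (in particular, `v` may be empty). -/
def IsNormalForm (x : Cantor) (a : Start) (v w : List (Fin 2)) : Prop :=
  x = a.word ++ₛ (v ++ₛ periodic w) ∧ IsPrimitive w ∧ v.getLast? ≠ w.getLast?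

/-! ### Explicit graphs: trees hanging from a spine

Grey vertices sit on a spine (an infinite path or a cycle) with index set `I`, or in the binary
trees hanging down from it. The function `down` describes the spine: `down i = some (b, j)` means
that the spine vertex right below `i` is `j`, and that `j` is the child of `i` of type `b`, where
the child of type `0` is joined to its parent by an arrow labelled `x₁` and the child of
type `1` is joined to its parent through a white vertex. -/

/-- The pair `(i, p)` is the grey vertex reached from the spine vertex `i` by descending along the
finite word `p`, read from its last letter to its first letter. It is reduced if the path leaves
the spine at once. -/
def Reduced {I : Type} (down : I → Option (Fin 2 × I)) (c : I × List (Fin 2)) : Prop :=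
  ∀ b j, down c.1 = some (b, j) → c.2.getLast? ≠ some b

/-- The grey vertices. -/
def Grey {I : Type} (down : I → Option (Fin 2 × I)) : Type :=
  {c : I × List (Fin 2) // Reduced down c}

/-- `d` is the child of type `a` of the grey vertex `c`: either it is obtained by descending one
more step in a hanging tree, or both vertices are on the spine and `d` is right below `c`. -/
def IsChild {I : Type} (down : I → Option (Fin 2 × I)) (a : Fin 2) (c d : Grey down) : Prop :=
  d.1 = (c.1.1, a :: c.1.2) ∨ (c.1.2 = [] ∧ d.1.2 = [] ∧ down c.1.1 = some (a, d.1.1))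

/-- The arrows. The vertex `(c, white 0)` is the grey vertex `c` itself; to each grey vertex are
attached an infinite ray of black vertices `(c, black m)` and an infinite ray of white vertices
`(c, white n)`, `n ≥ 1`. -/
inductive SpineEdge {I : Type} (down : I → Option (Fin 2 × I)) :
    Gen → Grey down × Start → Grey down × Start → Prop
  | x0_black (c : Grey down) (m : ℕ) : SpineEdge down .x0 (c, .black m) (c, .black (m + 1))
  | x0_grey (c : Grey down) : SpineEdge down .x0 (c, .white 0) (c, .black 0)
  | x0_white (c : Grey down) (n : ℕ) : SpineEdge down .x0 (c, .white (n + 1)) (c, .white n)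
  | x1_black (c : Grey down) (m : ℕ) : SpineEdge down .x1 (c, .black m) (c, .black m)
  | x1_grey (c d : Grey down) (h : IsChild down 0 c d) :
      SpineEdge down .x1 (c, .white 0) (d, .white 0)
  | x1_white_one (c d : Grey down) (h : IsChild down 1 c d) :
      SpineEdge down .x1 (c, .white 1) (d, .white 0)
  | x1_white (c : Grey down) (n : ℕ) : SpineEdge down .x1 (c, .white (n + 2)) (c, .white (n + 1))

/-- The marked graph with the given spine. -/
def spineGraph {I : Type} (down : I → Option (Fin 2 × I)) :
    MarkedGraph (Grey down × Start) where
  edge := SpineEdge down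

/-- The infinite spine with vertices `0, 1, 2, …` going upwards that turns at its successive levels
according to the successive letters of `u`. -/
def rayDown (u : Cantor) : ℕ → Option (Fin 2 × ℕ)
  | 0 => none
  | k + 1 => some (u.get k, k)

/-- The limit graph of type B whose infinite path going up turns left or right at the `k`-th level
if the `k`-th letter of `u` is `0` or `1` respectively. -/
def typeB (u : Cantor) : MarkedGraph (Grey (rayDown u) × Start) := spineGraph (rayDown u)

/-- The label of a vertex of the limit graph of type B. -/
def typeBLabel (u : Cantor) (t : Grey (rayDown u) × Start) : Cantor :=
  t.2.word ++ₛ (t.1.1.2 ++ₛ u.drop t.1.1.1)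

/-- The vertex of the limit graph of type B with label `a u` and bottom of the infinite path as its
grey vertex. The graph `typeB u` with this base vertex is the limit graph of the point `a u`. -/
def typeBBase (u : Cantor) (a : Start) : Grey (rayDown u) × Start :=
  (⟨(0, []), fun _ _ h => by simp [rayDown] at h⟩, a)

/-- The cyclic spine of length `|w|`: the vertex right below `i` is `i - 1` modulo `|w|`, and the
step from `i - 1` up to `i` turns according to the letter of `w` with (zero-based) index `i - 1`
modulo `|w|`. -/
def cycleDown (w : List (Fin 2)) (i : Fin w.length) : Option (Fin 2 × Fin w.length) :=
  let j : Fin w.length := ⟨(i + (w.length - 1)) % w.length, Nat.mod_lt _ (i.pos)⟩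
  some (w.get j, j)

/-- The graph consisting of one loop with `|w|` grey vertices that turns according to the
letters of `w`, and of the trees and rays attached to this loop. -/
def loopGraph (w : List (Fin 2)) : MarkedGraph (Grey (cycleDown w) × Start) :=
  spineGraph (cycleDown w)

/-! ### Pieces of Schreier graphs -/

/-- The point `1000…` (the binary expansion of `1/2`). -/
def half : Cantor := [1] ++ₛ constWord 0

/-- Grey vertices are those with labels `10z`. -/
def IsGrey {x : Cantor} (p : Orb x) : Prop := ∃ z : Cantor, (p : Cantor) = [1, 0] ++ₛ z

/-- White vertices are those with labels `11z`. -/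
def IsWhite {x : Cantor} (p : Orb x) : Prop := ∃ z : Cantor, (p : Cantor) = [1, 1] ++ₛ z

/-- The vertices of the tree hanging down from the grey vertex `10u`: the grey vertices
`10pu` with `p` a finite word, together with the black and the white rays at these
vertices. -/
def treeAt (x u : Cantor) : Set (Orb x) :=
  {y | ∃ (b : Start) (p : List (Fin 2)), (y : Cantor) = b.word ++ₛ (p ++ₛ u)}

/-- The vertices of the tree hanging down and to the left at the white vertex `110z`: the white
ray `110z, 1110z, …` and the tree hanging down from the grey vertex `101z`. -/
def leftTreeAt (x z : Cantor) : Set (Orb x) :=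
  {y | ∃ n : ℕ, (y : Cantor) = (Start.white (n + 1)).word ++ₛ z} ∪ treeAt x ([1] ++ₛ z)

/-- One step up from the grey vertex `p` to the grey vertex `q`. The step turns left (letter `0`) if
it goes along an arrow labelled `x₁` from `q` to `p`, and it turns right (letter `1`) if it
goes through a white vertex with arrows labelled `x₀` to `q` and `x₁` to `p`. -/
def StepUp {x : Cantor} (a : Fin 2) (p q : Orb x) : Prop :=
  IsGrey p ∧ IsGrey q ∧
    ((a = 0 ∧ (schreier x).edge .x1 q p) ∨
      (a = 1 ∧ ∃ t : Orb x, IsWhite t ∧ (schreier x).edge .x0 t q ∧ (schreier x).edge .x1 t p))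

/-- The labels of the vertices of the nontrivial loop, in cyclic order: the grey vertices
`10σ^i(w^∞)`, `0 ≤ i < |w|`, where `10σ^i(w^∞)` is followed by the white vertex `110σ^(i+1)(w^∞)`
if the letter of `w` with (zero-based) index `i` is `1`. -/
def loopLabels (w : List (Fin 2)) : List Cantor :=
  (List.range w.length).flatMap fun i =>
    if (periodic w).get i = 0 then [[1, 0] ++ₛ (periodic w).drop i]
    else [[1, 0] ++ₛ (periodic w).drop i, [1, 1, 0] ++ₛ (periodic w).drop (i + 1)]

/-- The vertex set of the nontrivial loop. -/
def loopSet (x : Cantor) (w : List (Fin 2)) : Set (Orb x) := {y | (y : Cantor) ∈ loopLabels w}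

/-! ### The action in terms of normal forms -/

/-! Write a nonconstant point as `b p z` with `b` a start, `p` a finite word and `z` a fixed tail.
The generators never look at `z`: they act on the codes `(b, p)` alone (`perm_lab`). Only the
`x₁`-preimage of `10z` needs the first letter of `z` (`exists_act_eq`). So the same tree of codes
lies below every grey vertex `10z`, and two such trees can differ only in which codes receive equal
labels.

A coincidence `b p z = b p' z` with `p ≠ p'` gives `q z = z` for some nonempty `q`. If `z` is not
purely periodic, the labels are therefore injective, and the tree below `10z` is a copy of the one
below `101` in the graph of 1/2 (`exists_iso_codeSet`). In the orbit of a rational point all tails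
are tail equivalent to `w^∞`, so the purely periodic ones are the shifts of `w^∞`
(`notPeriodic_of_tailEq`). Since `w` is primitive there are exactly `|w|` of them, the grey vertices
of the loop.

For the graphs with a spine, the labelling turns arrows into the action of the generators. Every
vertex has an outgoing arrow of each kind, and the Schreier graph has only one, so a surjective
labelling becomes an isomorphism after gluing (`exists_glue_iso`). For the cyclic spine the
labelling is already injective (`cycle_spineLab_injective`).

A tree attached to the loop at `10z` has a purely periodic `z`, but its own tail `0z` or `1z` is not
a shift of `w^∞`, since otherwise its root would lie on the loop. The black rays are geodesic
because an arrow changes the number of leading zeros by at most one. -/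

theorem x0Fun_zero (z : Cantor) : x0Fun ([0] ++ₛ z) = [0, 0] ++ₛ z := rfl
theorem x0Fun_one_zero (z : Cantor) : x0Fun ([1, 0] ++ₛ z) = [0, 1] ++ₛ z := rfl
theorem x0Fun_one_one (z : Cantor) : x0Fun ([1, 1] ++ₛ z) = [1] ++ₛ z := rfl
theorem x1Fun_zero (z : Cantor) : x1Fun ([0] ++ₛ z) = [0] ++ₛ z := rfl
theorem x1Fun_one_zero (z : Cantor) : x1Fun ([1, 0] ++ₛ z) = [1, 0, 0] ++ₛ z := rfl
theorem x1Fun_one_one_zero (z : Cantor) : x1Fun ([1, 1, 0] ++ₛ z) = [1, 0, 1] ++ₛ z := rfl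
theorem x1Fun_one_one_one (z : Cantor) : x1Fun ([1, 1, 1] ++ₛ z) = [1, 1] ++ₛ z := rfl

/-- The point `b p z` determined by the code `(b, p)`. -/
def lab (z : Cantor) (c : Start × List (Fin 2)) : Cantor := c.1.word ++ₛ (c.2 ++ₛ z)

/-- The action of the generators on codes. -/
def act : Gen → Start × List (Fin 2) → Start × List (Fin 2)
  | .x0, (.black m, p) => (.black (m + 1), p)
  | .x0, (.white 0, p) => (.black 0, p)
  | .x0, (.white (n + 1), p) => (.white n, p)
  | .x1, (.black m, p) => (.black m, p)
  | .x1, (.white 0, p) => (.white 0, 0 :: p)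
  | .x1, (.white 1, p) => (.white 0, 1 :: p)
  | .x1, (.white (n + 2), p) => (.white (n + 1), p)

theorem perm_lab (s : Gen) (z : Cantor) (c : Start × List (Fin 2)) :
    s.perm (lab z c) = lab z (act s c) := by
  obtain ⟨b, p⟩ := c
  cases s
  · rcases b with m | _ | n
    · exact x0Fun_zero _
    · exact x0Fun_one_zero _
    · exact x0Fun_one_one _
  · rcases b with m | _ | _ | n
    · exact x1Fun_zero _
    · exact x1Fun_one_zero _
    · exact x1Fun_one_one_zero _
    · exact x1Fun_one_one_one _

/-- Codes can be followed backwards except at the root `10z`, whose `x₁`-preimage depends on the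
first letter of `z`. This is why a tree of codes can be entered from outside only at its root. -/
theorem exists_act_eq (s : Gen) (c : Start × List (Fin 2)) :
    (∃ d, act s d = c) ∨ c = (.white 0, []) := by
  obtain ⟨b, p⟩ := c
  cases s
  · rcases b with (_ | m) | n
    · exact .inl ⟨(.white 0, p), rfl⟩
    · exact .inl ⟨(.black m, p), rfl⟩
    · exact .inl ⟨(.white (n + 1), p), rfl⟩
  · rcases b with m | _ | n
    · exact .inl ⟨(.black m, p), rfl⟩
    · rcases p with _ | ⟨a, p⟩
      · exact .inr rfl
      · match a with
        | 0 => exact .inl ⟨(.white 0, p), rfl⟩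
        | 1 => exact .inl ⟨(.white 1, p), rfl⟩
    · exact .inl ⟨(.white (n + 2), p), rfl⟩

/-- The starts form a prefix code: comparing letters one by one, two of them first disagree no later
than where the shorter one ends. -/
theorem start_append_inj {b b' : Start} {t t' : Cantor} (h : b.word ++ₛ t = b'.word ++ₛ t') :
    b = b' ∧ t = t' := by
  rcases b with m | m <;> rcases b' with n | n
  · induction m generalizing n with
    | zero =>
      rcases n with _ | n
      · exact ⟨rfl, congrArg (Stream'.drop 2) h⟩
      · exact absurd (congrFun h 1) (show (1 : Fin 2) ≠ 0 by decide)
    | succ m ih =>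
      rcases n with _ | n
      · exact absurd (congrFun h 1) (show (0 : Fin 2) ≠ 1 by decide)
      · obtain ⟨h1, h2⟩ := ih n (congrArg Stream'.tail h)
        exact ⟨by cases h1; rfl, h2⟩
  · exact absurd (congrFun h 0) (show (0 : Fin 2) ≠ 1 by decide)
  · exact absurd (congrFun h 0) (show (1 : Fin 2) ≠ 0 by decide)
  · induction m generalizing n with
    | zero =>
      rcases n with _ | n
      · exact ⟨rfl, congrArg (Stream'.drop 2) h⟩
      · exact absurd (congrFun h 1) (show (0 : Fin 2) ≠ 1 by decide)
    | succ m ih =>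
      rcases n with _ | n
      · exact absurd (congrFun h 1) (show (1 : Fin 2) ≠ 0 by decide)
      · obtain ⟨h1, h2⟩ := ih n (congrArg Stream'.tail h)
        exact ⟨by cases h1; rfl, h2⟩

theorem exists_start (x : Cantor) (h0 : x ≠ constWord 0) (h1 : x ≠ constWord 1) :
    ∃ (b : Start) (t : Cantor), x = b.word ++ₛ t := by
  -- Induction on the position of some letter that differs from the first one: if the first two
  -- letters agree, delete one of them.
  have key : ∀ n (x : Cantor), x.get n ≠ x.get 0 → ∃ (b : Start) (t : Cantor), x = b.word ++ₛ t := by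
    intro n
    induction n with
    | zero => intro x h; exact absurd rfl h
    | succ n ih =>
      intro x h
      obtain ⟨a, b, t, rfl⟩ : ∃ (a b : Fin 2) (t : Cantor), x = [a, b] ++ₛ t := by
        obtain ⟨a, b, c, t, rfl⟩ := exists_eq_append x
        exact ⟨a, b, [c] ++ₛ t, rfl⟩
      by_cases hab : a = b
      · subst hab
        obtain ⟨c, t', hc⟩ := ih ([a] ++ₛ t) h
        have ha : a = c.word.head! := by
          have := congrFun hc 0
          rcases c with m | m <;> exact this
        rcases c with m | m
        · refine ⟨.black (m + 1), t', ?_⟩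
          change [a] ++ₛ ([a] ++ₛ t) = _
          rw [hc, ha]; rfl
        · refine ⟨.white (m + 1), t', ?_⟩
          change [a] ++ₛ ([a] ++ₛ t) = _
          rw [hc, ha]; rfl
      · match a, b with
        | 0, 0 => exact absurd rfl hab
        | 1, 1 => exact absurd rfl hab
        | 0, 1 => exact ⟨.black 0, t, rfl⟩
        | 1, 0 => exact ⟨.white 0, t, rfl⟩
  by_contra hc
  have hall : ∀ n, x.get n = x.get 0 := fun n => by
    by_contra h
    exact hc (key n x h)
  generalize hg : x.get 0 = a at hall
  match a with
  | 0 => exact h0 (funext hall)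
  | 1 => exact h1 (funext hall)

/-! ### Orbits -/

theorem perm_mem_orbit_iff {x y : Cantor} (s : Gen) :
    s.perm y ∈ MulAction.orbit thompsonF x ↔ y ∈ MulAction.orbit thompsonF x := by
  constructor
  · rintro ⟨g, hg⟩
    refine ⟨s.elt⁻¹ * g, ?_⟩
    change s.elt⁻¹ • g • x = y
    change g • x = s.perm y at hg
    rw [hg]
    exact s.perm.symm_apply_apply y
  · rintro ⟨g, rfl⟩
    exact ⟨s.elt * g, rfl⟩

/-- The permutations that preserve and reflect membership in `T` form a subgroup, so it suffices to
test the two generators. -/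
theorem mem_of_mem_orbit {x y : Cantor} {T : Set Cantor} (hT : ∀ (s : Gen) z, s.perm z ∈ T ↔ z ∈ T)
    (hx : x ∈ T) (hy : y ∈ MulAction.orbit thompsonF x) : y ∈ T := by
  obtain ⟨⟨g, hg⟩, rfl⟩ := hy
  have key : ∀ z, g z ∈ T ↔ z ∈ T := by
    refine Subgroup.closure_induction (p := fun g _ => ∀ z, g z ∈ T ↔ z ∈ T) ?_ ?_ ?_ ?_ hg
    · rintro _ ⟨s, rfl⟩
      exact hT s
    · intro z; rfl
    · intro g h _ _ hg hh z
      exact (hg (h z)).trans (hh z)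
    · intro g _ hg z
      rw [← hg (g⁻¹ z), show g (g⁻¹ z) = z from g.apply_symm_apply z]
  exact (key x).2 hx

theorem lab_mem_orbit_iff_grey {x z : Cantor} (b : Start) (p : List (Fin 2)) :
    lab z (b, p) ∈ MulAction.orbit thompsonF x ↔
      lab z (.white 0, p) ∈ MulAction.orbit thompsonF x := by
  rcases b with m | m
  · induction m with
    | zero => rw [← perm_mem_orbit_iff .x0 (y := lab z (.white 0, p)), perm_lab]; rfl
    | succ m ih => rw [← ih, ← perm_mem_orbit_iff .x0 (y := lab z (.black m, p)), perm_lab]; rfl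
  · induction m with
    | zero => rfl
    | succ m ih => rw [← ih, ← perm_mem_orbit_iff .x0, perm_lab]; rfl

/-- The tree of codes is connected: `x₀` runs along the rays, and `x₁` leads to each child, either
from its parent or from the parent's first white vertex. -/
theorem lab_mem_orbit_iff {x z : Cantor} (b : Start) (p : List (Fin 2)) :
    lab z (b, p) ∈ MulAction.orbit thompsonF x ↔
      lab z (.white 0, []) ∈ MulAction.orbit thompsonF x := by
  rw [lab_mem_orbit_iff_grey]
  induction p with
  | nil => rfl
  | cons a p ih =>
    rw [← ih]
    match a with
    | 0 => rw [← perm_mem_orbit_iff .x1 (y := lab z (.white 0, p)), perm_lab]; rfl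
    | 1 =>
      rw [← lab_mem_orbit_iff_grey (.white 1) p,
        ← perm_mem_orbit_iff .x1 (y := lab z (.white 1, p)), perm_lab]
      rfl

theorem start_mem_orbit_iff {x z : Cantor} (b : Start) (p : List (Fin 2)) :
    b.word ++ₛ (p ++ₛ z) ∈ MulAction.orbit thompsonF x ↔
      [1, 0] ++ₛ z ∈ MulAction.orbit thompsonF x :=
  lab_mem_orbit_iff b p

/-! ### Orbit invariants: nonconstancy and the tail class. -/

theorem perm_const (s : Gen) (a : Fin 2) : s.perm (constWord a) = constWord a := by
  match s, a with
  | .x0, 0 => exact funext fun n => by rcases n with _ | _ | n <;> rfl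
  | .x0, 1 => exact funext fun n => by rcases n with _ | _ | n <;> rfl
  | .x1, 0 => rfl
  | .x1, 1 => exact funext fun n => by rcases n with _ | _ | _ | n <;> rfl

theorem exists_drop_perm_eq (s : Gen) (z : Cantor) : ∃ m k, (s.perm z).drop m = z.drop k := by
  obtain ⟨a, b, c, t, rfl⟩ := exists_eq_append z
  match s, a, b, c with
  | .x0, 0, _, _ => exact ⟨4, 3, rfl⟩
  | .x0, 1, 0, _ => exact ⟨3, 3, rfl⟩
  | .x0, 1, 1, _ => exact ⟨2, 3, rfl⟩
  | .x1, 0, _, _ => exact ⟨3, 3, rfl⟩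
  | .x1, 1, 0, _ => exact ⟨4, 3, rfl⟩
  | .x1, 1, 1, 0 => exact ⟨3, 3, rfl⟩
  | .x1, 1, 1, 1 => exact ⟨2, 3, rfl⟩

/-- Two points are tail equivalent if some of their shifts agree. -/
def TailEq (y x : Cantor) : Prop := ∃ m k, y.drop m = x.drop k

theorem TailEq.symm {x y : Cantor} : TailEq x y → TailEq y x :=
  fun ⟨m, k, h⟩ => ⟨k, m, h.symm⟩

theorem TailEq.trans {x y z : Cantor} : TailEq x y → TailEq y z → TailEq x z := by
  rintro ⟨m, k, h⟩ ⟨m', k', h'⟩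
  refine ⟨m + m', k' + k, ?_⟩
  rw [← Stream'.drop_drop, h, Stream'.drop_drop, add_comm k, ← Stream'.drop_drop, h',
    Stream'.drop_drop]

/-- Both generators fix the constant words and alter only a finite beginning, so being nonconstant
and being tail equivalent to `x` are invariant under `F`. -/
theorem exists_start_of_mem_orbit {x y : Cantor} (h0 : x ≠ constWord 0) (h1 : x ≠ constWord 1)
    (hy : y ∈ MulAction.orbit thompsonF x) :
    ∃ (b : Start) (t : Cantor), y = b.word ++ₛ t ∧ TailEq t x := by
  have hne : ∀ a, x ≠ constWord a → y ≠ constWord a := fun a ha =>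
    mem_of_mem_orbit (T := {z | z ≠ constWord a}) (fun s z => by
      rw [Set.mem_ofPred_eq, Set.mem_ofPred_eq, ← perm_const s a, s.perm.injective.ne_iff,
        perm_const]) ha hy
  have ht : TailEq y x := mem_of_mem_orbit (T := {z | TailEq z x}) (fun s z =>
    ⟨fun h => (TailEq.symm (exists_drop_perm_eq s z)).trans h,
      fun h => TailEq.trans (exists_drop_perm_eq s z) h⟩) ⟨0, 0, rfl⟩ hy
  obtain ⟨b, t, rfl⟩ := exists_start y (hne 0 h0) (hne 1 h1)
  exact ⟨b, t, rfl, TailEq.trans ⟨0, b.word.length, (Stream'.drop_append_stream _ _).symm⟩ ht⟩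

theorem schreier_edge_iff {x : Cantor} {s : Gen} {a b : Orb x} :
    (schreier x).edge s a b ↔ s.perm (a : Cantor) = b :=
  Subtype.ext_iff

/-! ### Combinatorics of words -/

theorem drop_append_add (p : List (Fin 2)) (z : Cantor) (k : ℕ) :
    (p ++ₛ z).drop (p.length + k) = z.drop k := by
  rw [← Stream'.drop_drop, Stream'.drop_append_stream]

theorem append_eq_append_of_le {p p' : List (Fin 2)} {z z' : Cantor} (h : p ++ₛ z = p' ++ₛ z')
    (hl : p.length ≤ p'.length) : ∃ q, p' = p ++ q ∧ z = q ++ₛ z' := by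
  have hp : p' = p ++ p'.drop p.length := by
    conv_lhs => rw [← List.take_append_drop p.length p']
    congr 1
    rw [← List.take_append_drop p.length p', Stream'.append_append_stream] at h
    exact (Stream'.append_left_injective _ _ _ _ h (by simp [hl])).symm
  refine ⟨p'.drop p.length, hp, ?_⟩
  rw [hp, Stream'.append_append_stream] at h
  exact Stream'.append_right_injective _ _ _ h

/-- A point is not purely periodic. -/
def NotPeriodic (z : Cantor) : Prop := ∀ q : List (Fin 2), q ++ₛ z = z → q = []

theorem NotPeriodic.append_inj {z : Cantor} (hz : NotPeriodic z) {p p' : List (Fin 2)}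
    (h : p ++ₛ z = p' ++ₛ z) : p = p' := by
  rcases le_total p.length p'.length with hl | hl
  · obtain ⟨q, rfl, hq⟩ := append_eq_append_of_le h hl
    rw [hz q hq.symm, List.append_nil]
  · obtain ⟨q, rfl, hq⟩ := append_eq_append_of_le h.symm hl
    rw [hz q hq.symm, List.append_nil]

theorem NotPeriodic.lab_inj {z : Cantor} (hz : NotPeriodic z) {c c' : Start × List (Fin 2)}
    (h : lab z c = lab z c') : c = c' := by
  obtain ⟨h1, h2⟩ := start_append_inj h
  exact Prod.ext h1 (hz.append_inj h2)

/-- If `z = q z` with `q` nonempty, then `z` reappears arbitrarily deep inside itself, hence in the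
part that it shares with `u`; it would be a shift of `u`. -/
theorem notPeriodic_of_tailEq {z u : Cantor} (h : TailEq z u) (hz : ∀ i, z ≠ u.drop i) :
    NotPeriodic z := by
  obtain ⟨m, k, h⟩ := h
  intro q hq
  by_contra hne
  have hd : z.drop q.length = z := by
    conv_lhs => rw [← hq]
    exact Stream'.drop_append_stream _ _
  have hN : ∀ n, z.drop (n * q.length) = z := by
    intro n
    induction n with
    | zero => rw [zero_mul]; rfl
    | succ n ih => rw [add_mul, one_mul, ← Stream'.drop_drop, ih, hd]
  have hl : 0 < q.length := List.length_pos_iff.2 hne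
  -- `e` is chosen so that `m + e` is the multiple `m * q.length` of the period.
  obtain ⟨e, he⟩ := Nat.exists_eq_add_of_le (Nat.le_mul_of_pos_right m hl)
  apply hz (k + e)
  rw [← Stream'.drop_drop, ← h, Stream'.drop_drop, ← he, hN]

theorem notPeriodic_append_half (p : List (Fin 2)) : NotPeriodic (p ++ₛ half) := by
  have ht : TailEq (p ++ₛ half) (constWord 0) := by
    refine ⟨p.length + 1, 0, ?_⟩
    rw [drop_append_add]; rfl
  refine notPeriodic_of_tailEq ht fun i h => ?_
  have h1 := congrFun (congrArg (Stream'.drop p.length) h) 0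
  rw [Stream'.drop_append_stream] at h1
  exact absurd h1 (show (1 : Fin 2) ≠ 0 by decide)

/-! ### Periods of `w^∞` for primitive `w`. -/

theorem periodic_get (w : List (Fin 2)) (n : ℕ) :
    (periodic w).get n = w.getD (n % w.length) 0 := rfl

theorem periodic_get_of_lt {w : List (Fin 2)} {n : ℕ} (h : n < w.length) :
    (periodic w).get n = w[n] := by
  rw [periodic_get, Nat.mod_eq_of_lt h, List.getD_eq_getElem _ _ h]

theorem periodic_drop_mod (w : List (Fin 2)) (n : ℕ) :
    (periodic w).drop (n % w.length) = (periodic w).drop n := by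
  funext i
  change w.getD ((i + n % w.length) % w.length) 0 = w.getD ((i + n) % w.length) 0
  rw [Nat.add_mod_mod]

theorem periodic_take (w : List (Fin 2)) : (periodic w).take w.length = w := by
  apply List.ext_getElem (Stream'.length_take _ _)
  intro i h1 h2
  rw [← Option.some_inj, ← List.getElem?_eq_getElem, Stream'.getElem?_take h2,
    periodic_get_of_lt h2]

theorem append_periodic (w : List (Fin 2)) : w ++ₛ periodic w = periodic w := by
  conv_rhs => rw [← Stream'.append_take_drop w.length (periodic w), periodic_take,
    ← periodic_drop_mod, Nat.mod_self, Stream'.drop_zero]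

theorem take_mul_of_drop_eq {z : Cantor} {g : ℕ} (h : z.drop g = z) (n : ℕ) :
    z.take (n * g) = (List.replicate n (z.take g)).flatten := by
  induction n with
  | zero => simp
  | succ n ih =>
    rw [add_mul, one_mul, add_comm, Stream'.take_add, h, ih, List.replicate_succ,
      List.flatten_cons]

theorem drop_mul_eq {z : Cantor} {g : ℕ} (h : z.drop g = z) (n : ℕ) : z.drop (g * n) = z := by
  induction n with
  | zero => rfl
  | succ n ih => rw [mul_add, mul_one, ← Stream'.drop_drop, ih, h]

/-- By division with remainder the least period `g` divides every period, in particular `|w|`. Then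
`w` is a power of its first `g` letters, so primitivity gives `g = |w|`. -/
theorem dvd_of_drop_eq {w : List (Fin 2)} (hw : IsPrimitive w) {d : ℕ}
    (h : (periodic w).drop d = periodic w) : w.length ∣ d := by
  have hl : 0 < w.length := List.length_pos_iff.2 hw.1
  have hL : (periodic w).drop w.length = periodic w := by
    rw [← periodic_drop_mod, Nat.mod_self, Stream'.drop_zero]
  have hex : ∃ g, 0 < g ∧ (periodic w).drop g = periodic w := ⟨w.length, hl, hL⟩
  classical
  obtain ⟨hg0, hg⟩ := Nat.find_spec hex
  have hmin : ∀ m, m < Nat.find hex → ¬ _ := fun m => Nat.find_min hex (m := m)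
  generalize Nat.find hex = g at hg0 hg hmin
  have key : ∀ e, (periodic w).drop e = periodic w → g ∣ e := by
    intro e he
    by_contra hnd
    refine hmin (e % g) (Nat.mod_lt _ hg0)
      ⟨Nat.pos_of_ne_zero fun h0 => hnd (Nat.dvd_of_mod_eq_zero h0), ?_⟩
    rw [← Nat.mod_add_div e g, add_comm, ← Stream'.drop_drop, drop_mul_eq hg] at he
    exact he
  obtain ⟨n, hn⟩ := key _ hL
  have hn1 : n = 1 := by
    apply hw.2 ((periodic w).take g) n
    rw [← take_mul_of_drop_eq hg, mul_comm, ← hn, periodic_take]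
  rw [hn, hn1, mul_one]
  exact key d h

theorem dvd_of_periodic_drop_eq {w : List (Fin 2)} (hw : IsPrimitive w) {k d : ℕ}
    (h : (periodic w).drop (k + d) = (periodic w).drop k) : w.length ∣ d := by
  apply dvd_of_drop_eq hw
  have hl : 0 < w.length := List.length_pos_iff.2 hw.1
  -- Shifting by `e` more letters, where `k + e = |w| * k`, reduces to the case `k = 0`.
  obtain ⟨e, he⟩ := Nat.exists_eq_add_of_le (Nat.le_mul_of_pos_left k hl)
  have h2 := congrArg (Stream'.drop e) h
  rw [Stream'.drop_drop, Stream'.drop_drop, ← he, ← periodic_drop_mod _ (w.length * k),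
    Nat.mul_mod_right, Stream'.drop_zero, ← periodic_drop_mod,
    show k + d + e = d + w.length * k by omega, Nat.add_mul_mod_self_left, periodic_drop_mod] at h2
  exact h2

/-- If the repetition began before the end of `v`, the last letter of `v` would recur `d` places
later, at the end of a copy of `w`; the normal form forbids this. -/
theorem drop_eq_imp {v w : List (Fin 2)} (hw : IsPrimitive w) (hv : v.getLast? ≠ w.getLast?)
    {k d : ℕ} (hd : 0 < d)
    (h : (v ++ₛ periodic w).drop (k + d) = (v ++ₛ periodic w).drop k) :
    v.length ≤ k ∧ w.length ∣ d := by
  have hl : 0 < w.length := List.length_pos_iff.2 hw.1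
  have hdvd : w.length ∣ d := by
    apply dvd_of_periodic_drop_eq hw (k := k)
    have h2 := congrArg (Stream'.drop v.length) h
    rw [Stream'.drop_drop, Stream'.drop_drop, add_comm, drop_append_add, add_comm k v.length,
      drop_append_add] at h2
    exact h2
  refine ⟨?_, hdvd⟩
  by_contra hlt
  rw [not_le] at hlt
  apply hv
  obtain ⟨e, rfl⟩ := hdvd
  obtain ⟨e, rfl⟩ : ∃ e', e = e' + 1 := Nat.exists_eq_succ_of_ne_zero fun h0 => by simp [h0] at hd
  have h2 := congrArg (fun z => Stream'.get z (v.length - 1 - k)) h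
  simp only [Stream'.get_drop] at h2
  rw [show k + (v.length - 1 - k) = v.length - 1 by omega,
    show k + w.length * (e + 1) + (v.length - 1 - k) = v.length + (w.length * e + (w.length - 1)) by
      rw [mul_add]; omega,
    Stream'.get_append_left _ _ _ (by omega : v.length - 1 < v.length)] at h2
  have h3 := congrArg (fun z => Stream'.get z 0)
    (drop_append_add v (periodic w) (w.length * e + (w.length - 1)))
  simp only [Stream'.get_drop, add_zero] at h3
  rw [h3, periodic_get, Nat.mul_add_mod, Nat.mod_eq_of_lt (by omega),
    List.getD_eq_getElem _ _ (by omega)] at h2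
  rw [List.getLast?_eq_getElem?, List.getLast?_eq_getElem?,
    List.getElem?_eq_getElem (by omega), List.getElem?_eq_getElem (by omega), h2]

theorem periodic_drop_inj {w : List (Fin 2)} (hw : IsPrimitive w) {i j : ℕ} (hi : i < w.length)
    (hj : j < w.length) (h : (periodic w).drop i = (periodic w).drop j) : i = j := by
  wlog hij : i ≤ j generalizing i j
  · exact (this hj hi h.symm (le_of_not_ge hij)).symm
  obtain ⟨d, rfl⟩ := Nat.exists_eq_add_of_le hij
  have := Nat.eq_zero_of_dvd_of_lt (dvd_of_periodic_drop_eq hw h.symm) (by omega)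
  omega

/-! ### Existence and uniqueness of the normal form -/

theorem drop_length_add_length (v w : List (Fin 2)) :
    (v ++ₛ periodic w).drop (v.length + w.length) = (v ++ₛ periodic w).drop v.length := by
  rw [drop_append_add, Stream'.drop_append_stream, ← periodic_drop_mod, Nat.mod_self,
    Stream'.drop_zero]

/-- Each decomposition supplies a repetition to which `drop_eq_imp` for the other applies; by
symmetry the lengths agree. -/
theorem normalForm_unique {v w v' w' : List (Fin 2)} (hw : IsPrimitive w) (hw' : IsPrimitive w')
    (hv : v.getLast? ≠ w.getLast?) (hv' : v'.getLast? ≠ w'.getLast?)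
    (h : v ++ₛ periodic w = v' ++ₛ periodic w') : v = v' ∧ w = w' := by
  have hl : 0 < w.length := List.length_pos_iff.2 hw.1
  have hl' : 0 < w'.length := List.length_pos_iff.2 hw'.1
  have h1 := drop_eq_imp hw hv hl' (h ▸ drop_length_add_length v' w')
  have h2 := drop_eq_imp hw' hv' hl (h ▸ drop_length_add_length v w)
  have hvl := le_antisymm h1.1 h2.1
  have hwl := Nat.dvd_antisymm h1.2 h2.2
  have hvv := Stream'.append_left_injective _ _ _ _ h hvl
  subst hvv
  refine ⟨rfl, ?_⟩
  rw [← periodic_take w, ← periodic_take w', Stream'.append_right_injective _ _ _ h, hwl]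

theorem eq_periodic_of_drop_eq {z : Cantor} {g : ℕ} (hg : 0 < g) (h : z.drop g = z) :
    z = periodic (z.take g) := by
  funext n
  change _ = (z.take g).getD (n % (z.take g).length) 0
  rw [Stream'.length_take, List.getD_eq_getElem?_getD,
    Stream'.getElem?_take (Nat.mod_lt _ hg), Option.getD_some]
  conv_lhs => rw [← Nat.mod_add_div n g]
  have := congrFun (drop_mul_eq h (n / g)) (n % g)
  exact this

theorem eq_periodic_of_append_eq {z : Cantor} {t : List (Fin 2)} (ht : t ≠ [])
    (h : t ++ₛ z = z) : z = periodic t := by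
  have hd : z.drop t.length = z := by
    conv_lhs => rw [← h, Stream'.drop_append_stream]
  have htake : z.take t.length = t := by
    apply Stream'.append_left_injective _ _ (z.drop t.length) z _ (Stream'.length_take _ _)
    rw [Stream'.append_take_drop, h]
  rw [eq_periodic_of_drop_eq (List.length_pos_iff.2 ht) hd, htake]

theorem periodic_flatten_replicate {t : List (Fin 2)} {n : ℕ}
    (h : (List.replicate n t).flatten ≠ []) :
    t ++ₛ periodic (List.replicate n t).flatten = periodic (List.replicate n t).flatten := by
  apply eq_periodic_of_append_eq h
  rw [← Stream'.append_append_stream,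
    show (List.replicate n t).flatten ++ t = t ++ (List.replicate n t).flatten by
      rw [← List.flatten_cons, ← List.replicate_succ, List.replicate_succ', List.flatten_append]
      simp,
    Stream'.append_append_stream, append_periodic]

/-- Take the least eventual period and then the least preperiod. If `w` were a proper power there
would be a smaller period; if the last letters of `v` and `w` agreed, the preperiod could be
shortened by one. -/
theorem exists_normalForm {u : Cantor} (hu : IsRational u) :
    ∃ v w, u = v ++ₛ periodic w ∧ IsPrimitive w ∧ v.getLast? ≠ w.getLast? := by
  classical
  have hex : ∃ p, 0 < p ∧ ∃ k, u.drop (k + p) = u.drop k := by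
    obtain ⟨k, p, hp, h⟩ := hu
    exact ⟨p, hp, k, h⟩
  obtain ⟨hp, hk⟩ := Nat.find_spec hex
  have hpmin : ∀ m, m < Nat.find hex → ¬ _ := fun m => Nat.find_min hex (m := m)
  generalize Nat.find hex = p at hp hk hpmin
  have hks := Nat.find_spec hk
  have hkmin : ∀ m, m < Nat.find hk → ¬ _ := fun m => Nat.find_min hk (m := m)
  generalize Nat.find hk = k at hks hkmin
  have hper := eq_periodic_of_drop_eq hp ((Stream'.drop_drop _ _ _).trans hks)
  refine ⟨u.take k, (u.drop k).take p, ?_, ⟨?_, ?_⟩, ?_⟩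
  · rw [← hper, Stream'.append_take_drop]
  · exact List.length_pos_iff.1 (by rwa [Stream'.length_take])
  · intro t n h
    have hlen : p = n * t.length := by
      simpa using congrArg List.length h
    have hn : 0 < n := Nat.pos_of_ne_zero fun h0 => by simp [h0] at hlen; omega
    have ht : 0 < t.length := Nat.pos_of_ne_zero fun h0 => by simp [h0] at hlen; omega
    by_contra hne
    refine hpmin t.length (by rw [hlen]; nlinarith [show 2 ≤ n by omega]) ⟨ht, k, ?_⟩
    have h2 := periodic_flatten_replicate (t := t) (n := n)
      (List.length_pos_iff.1 (by rwa [← h, Stream'.length_take]))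
    rw [← h, ← hper] at h2
    have h3 := congrArg (Stream'.drop t.length) h2
    rwa [Stream'.drop_append_stream, eq_comm, Stream'.drop_drop] at h3
  · rcases k with _ | k
    · rw [Stream'.take_zero, List.getLast?_nil, ne_comm, Ne, List.getLast?_eq_none_iff]
      exact List.length_pos_iff.1 (by rwa [Stream'.length_take])
    · obtain ⟨p, rfl⟩ : ∃ q, p = q + 1 := Nat.exists_eq_succ_of_ne_zero hp.ne'
      rw [Stream'.take_succ', Stream'.take_succ', List.getLast?_append, List.getLast?_append]
      intro heq
      apply hkmin k (Nat.lt_succ_self k)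
      simp only [List.getLast?_singleton, Option.some_or, Option.some_inj, Stream'.get_drop] at heq
      rw [← Stream'.eta (u.drop k), ← Stream'.eta (u.drop (k + (p + 1)))]
      rw [Stream'.head_drop, Stream'.head_drop, Stream'.tail_drop', Stream'.tail_drop', heq,
        ← hks]
      congr 2 <;> omega

/-! ### Graphs labelled by an orbit -/

/-- Only preservation of arrows has to be assumed. Arrows are also reflected, because by `hex` an
arrow of each kind leaves every vertex, and its target has the label prescribed by the generator. -/
theorem exists_glue_iso {V : Type} {Γ : MarkedGraph V} {l : V → Cantor} {x : Cantor}
    (hmem : ∀ t, l t ∈ MulAction.orbit thompsonF x)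
    (hsurj : ∀ y ∈ MulAction.orbit thompsonF x, ∃ t, l t = y)
    (hedge : ∀ s t t', Γ.edge s t t' → s.perm (l t) = l t')
    (hex : ∀ s t, ∃ t', Γ.edge s t t') :
    ∃ φ : (Γ.glue l).Iso (schreier x),
      ∀ t, ((φ.toEquiv (Quotient.mk _ t) : Orb x) : Cantor) = l t := by
  let f : Quotient (Setoid.ker l) → Orb x :=
    Quotient.lift (fun t => (⟨l t, hmem t⟩ : Orb x)) fun a b h => Subtype.ext h
  have hf : Function.Bijective f := by
    constructor
    · intro A B
      refine Quotient.inductionOn₂ A B fun a b h => Quotient.sound ?_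
      exact congrArg Subtype.val h
    · rintro ⟨y, hy⟩
      obtain ⟨t, rfl⟩ := hsurj y hy
      exact ⟨Quotient.mk _ t, rfl⟩
  refine ⟨⟨Equiv.ofBijective f hf, fun s A B => ?_⟩, fun t => rfl⟩
  rw [schreier_edge_iff]
  refine Quotient.inductionOn₂ A B fun a b => ⟨fun h => ?_, ?_⟩
  · obtain ⟨t, ht⟩ := hex s a
    exact ⟨a, t, rfl, Quotient.sound ((hedge s a t ht).symm.trans h), ht⟩
  · rintro ⟨a', b', ha, hb, h⟩
    rw [← ha, ← hb]
    exact hedge s a' b' h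

theorem exists_iso {V : Type} {Γ : MarkedGraph V} {l : V → Cantor} {x : Cantor}
    (hmem : ∀ t, l t ∈ MulAction.orbit thompsonF x)
    (hsurj : ∀ y ∈ MulAction.orbit thompsonF x, ∃ t, l t = y)
    (hedge : ∀ s t t', Γ.edge s t t' → s.perm (l t) = l t')
    (hex : ∀ s t, ∃ t', Γ.edge s t t') (hinj : Function.Injective l) :
    ∃ φ : Γ.Iso (schreier x), ∀ t, ((φ.toEquiv t : Orb x) : Cantor) = l t := by
  let f : V → Orb x := fun t => ⟨l t, hmem t⟩
  have hf : Function.Bijective f := by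
    refine ⟨fun a b h => hinj (congrArg Subtype.val h), ?_⟩
    rintro ⟨y, hy⟩
    obtain ⟨t, rfl⟩ := hsurj y hy
    exact ⟨t, rfl⟩
  refine ⟨⟨Equiv.ofBijective f hf, fun s a b => ?_⟩, fun t => rfl⟩
  rw [schreier_edge_iff]
  refine ⟨fun h => ?_, hedge s a b⟩
  obtain ⟨t, ht⟩ := hex s a
  rwa [← hinj ((hedge s a t ht).symm.trans h)]

/-! ### Graphs with a spine -/

/-- The label of a vertex of a graph with a spine, given labels `10 L(i)` of the spine vertices. -/
def spineLab {I : Type} {down : I → Option (Fin 2 × I)} (L : I → Cantor)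
    (t : Grey down × Start) : Cantor :=
  t.2.word ++ₛ (t.1.1.2 ++ₛ L t.1.1.1)

/-- The labels of the spine vertices are compatible with the steps down. -/
def SpineCompatible {I : Type} (down : I → Option (Fin 2 × I)) (L : I → Cantor) : Prop :=
  ∀ i a j, down i = some (a, j) → L j = [a] ++ₛ L i

section Spine

variable {I : Type} {down : I → Option (Fin 2 × I)} {L : I → Cantor}

theorem SpineCompatible.child (hL : SpineCompatible down L) {a : Fin 2} {c d : Grey down}
    (h : IsChild down a c d) : d.1.2 ++ₛ L d.1.1 = [a] ++ₛ (c.1.2 ++ₛ L c.1.1) := by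
  rcases h with h | ⟨h1, h2, h3⟩
  · rw [h]; rfl
  · rw [h1, h2, Stream'.nil_append_stream, Stream'.nil_append_stream, hL _ _ _ h3]

theorem SpineCompatible.edge (hL : SpineCompatible down L) (s : Gen) (t t' : Grey down × Start)
    (h : (spineGraph down).edge s t t') : s.perm (spineLab L t) = spineLab L t' := by
  rcases h with _ | _ | _ | _ | ⟨c, d, h⟩ | ⟨c, d, h⟩ | _
  · exact perm_lab .x0 _ (.black _, _)
  · exact perm_lab .x0 _ (.white 0, _)
  · exact perm_lab .x0 _ (.white (_ + 1), _)
  · exact perm_lab .x1 _ (.black _, _)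
  · refine (perm_lab .x1 _ (.white 0, _)).trans ?_
    exact congrArg (Stream'.appendStream' _) (hL.child h).symm
  · refine (perm_lab .x1 _ (.white 1, _)).trans ?_
    exact congrArg (Stream'.appendStream' _) (hL.child h).symm
  · exact perm_lab .x1 _ (.white (_ + 2), _)

/-- Adding a letter to a reduced pair destroys reducedness only when the word was empty and the
letter is that of the spine step down; the child is then the next spine vertex. -/
theorem exists_isChild (a : Fin 2) (c : Grey down) : ∃ d, IsChild down a c d := by
  by_cases h : Reduced down (c.1.1, a :: c.1.2)
  · exact ⟨⟨_, h⟩, .inl rfl⟩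
  · simp only [Reduced, not_forall, not_not] at h
    obtain ⟨b, j, h1, h2⟩ := h
    have hp : c.1.2 = [] := by
      by_contra hne
      rw [List.getLast?_cons_of_ne_nil hne] at h2
      exact c.2 b j h1 h2
    rw [hp, List.getLast?_singleton, Option.some_inj] at h2
    subst h2
    exact ⟨⟨(j, []), fun _ _ _ => by simp⟩, .inr ⟨hp, rfl, h1⟩⟩

theorem spineGraph_exists_edge (s : Gen) (t : Grey down × Start) :
    ∃ t', (spineGraph down).edge s t t' := by
  obtain ⟨c, b⟩ := t
  cases s
  · rcases b with m | _ | n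
    · exact ⟨_, .x0_black c m⟩
    · exact ⟨_, .x0_grey c⟩
    · exact ⟨_, .x0_white c n⟩
  · rcases b with m | _ | _ | n
    · exact ⟨_, .x1_black c m⟩
    · obtain ⟨d, hd⟩ := exists_isChild 0 c
      exact ⟨_, .x1_grey c d hd⟩
    · obtain ⟨d, hd⟩ := exists_isChild 1 c
      exact ⟨_, .x1_white_one c d hd⟩
    · exact ⟨_, .x1_white c n⟩

/-- A last letter of `p` that agrees with the spine step is absorbed by moving one vertex down the
spine, hence the induction from the right. -/
theorem SpineCompatible.exists_grey (hL : SpineCompatible down L) (i : I) (p : List (Fin 2)) :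
    ∃ c : Grey down, c.1.2 ++ₛ L c.1.1 = p ++ₛ L i := by
  induction p using List.reverseRecOn generalizing i with
  | nil => exact ⟨⟨(i, []), fun _ _ _ => by simp⟩, rfl⟩
  | append_singleton p a ih =>
    by_cases h : Reduced down (i, p ++ [a])
    · exact ⟨⟨_, h⟩, rfl⟩
    · simp only [Reduced, not_forall, not_not] at h
      obtain ⟨b, j, h1, h2⟩ := h
      rw [List.getLast?_concat, Option.some_inj] at h2
      subst h2
      obtain ⟨c, hc⟩ := ih j
      exact ⟨c, by rw [hc, hL _ _ _ h1, Stream'.append_append_stream]⟩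

theorem SpineCompatible.exists_spineLab_eq (hL : SpineCompatible down L) {i : I} {k : ℕ}
    {b : Start} {t u : Cantor} (hi : L i = u.drop k) {m : ℕ} (ht : t.drop m = u.drop k) :
    ∃ v : Grey down × Start, spineLab L v = b.word ++ₛ t := by
  obtain ⟨c, hc⟩ := hL.exists_grey i (t.take m)
  refine ⟨(c, b), ?_⟩
  change b.word ++ₛ (c.1.2 ++ₛ L c.1.1) = _
  rw [hc, hi, ← ht, Stream'.append_take_drop]

end Spine

theorem rayDown_compatible (u : Cantor) : SpineCompatible (rayDown u) u.drop := by
  rintro (_ | k) a j h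
  · exact absurd h (by simp [rayDown])
  · simp only [rayDown, Option.some_inj, Prod.mk.injEq] at h
    obtain ⟨rfl, rfl⟩ := h
    change u.drop k = [u.get k] ++ₛ u.drop (k + 1)
    rw [← Stream'.eta (u.drop k), Stream'.head_drop, Stream'.tail_drop']
    rfl

theorem cycleDown_compatible (w : List (Fin 2)) :
    SpineCompatible (cycleDown w) (fun i => (periodic w).drop i) := by
  intro i a j h
  simp only [cycleDown, Option.some_inj, Prod.mk.injEq] at h
  obtain ⟨rfl, rfl⟩ := h
  have hl := i.pos
  have hlt := Nat.mod_lt (i + (w.length - 1)) hl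
  have hi : (periodic w).drop i = (periodic w).drop ((i + (w.length - 1)) % w.length + 1) := by
    rw [← periodic_drop_mod _ (_ % _ + 1), Nat.mod_add_mod,
      show i + (w.length - 1) + 1 = i + w.length by omega, Nat.add_mod_right,
      Nat.mod_eq_of_lt i.2]
  change (periodic w).drop ((i + (w.length - 1)) % w.length) = _ ++ₛ (periodic w).drop i
  rw [hi]
  conv_lhs => rw [← Stream'.eta ((periodic w).drop _), Stream'.head_drop, Stream'.tail_drop',
    periodic_get_of_lt hlt]
  rfl

/-- If two labels agree and the words have different lengths, the longer word ends with the letter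
that precedes its spine tail in `w^∞`, contrary to reducedness. For equal lengths, primitivity
separates the spine vertices. -/
theorem cycle_spineLab_injective {w : List (Fin 2)} (hw : IsPrimitive w) :
    Function.Injective (spineLab (down := cycleDown w) fun i => (periodic w).drop i) := by
  rintro ⟨⟨⟨i, p⟩, hp⟩, b⟩ ⟨⟨⟨j, q⟩, hq⟩, b'⟩ h
  obtain ⟨rfl, h⟩ := start_append_inj h
  change p ++ₛ (periodic w).drop i = q ++ₛ (periodic w).drop j at h
  clear * - hw h hp hq
  suffices hs : i = j ∧ p = q by
    obtain ⟨rfl, rfl⟩ := hs; rfl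
  wlog hle : p.length ≤ q.length generalizing i j p q
  · obtain ⟨h1, h2⟩ := this j q hq i p hp h.symm (le_of_not_ge hle)
    exact ⟨h1.symm, h2.symm⟩
  obtain ⟨r, rfl, hr⟩ := append_eq_append_of_le h hle
  rcases List.eq_nil_or_concat r with rfl | ⟨r, a, rfl⟩
  · exact ⟨Fin.ext (periodic_drop_inj hw i.2 j.2 hr), (List.append_nil p).symm⟩
  · exfalso
    have hred : (p ++ r.concat a).getLast? ≠ _ := hq _ _ rfl
    rw [List.concat_eq_append, ← List.append_assoc, List.getLast?_concat] at hred
    have h1 := congrArg (Stream'.drop r.length) hr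
    rw [Stream'.drop_drop, List.concat_eq_append, Stream'.append_append_stream,
      Stream'.drop_append_stream] at h1
    -- The total shift past `i + r.length` is one full period, so the letter `a` is identified with
    -- the letter of `w` at the cyclic position `j - 1`.
    have h2 : (periodic w).drop (i + r.length + 1 + (w.length - 1)) =
        (periodic w).drop (j + (w.length - 1)) := by
      rw [← Stream'.drop_drop (w.length - 1), ← Stream'.drop_drop 1, h1, ← Stream'.drop_drop]
      rfl
    have hl := i.pos
    rw [← periodic_drop_mod, show i + r.length + 1 + (w.length - 1) = i + r.length + w.length by
      omega, Nat.add_mod_right, periodic_drop_mod, h1, ← periodic_drop_mod w (j + _)] at h2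
    have h3 := h2.trans (cycleDown_compatible w j _ _ rfl)
    exact hred (congrArg some (congrFun h3 0))

/-! ### Hanging pieces of Schreier graphs -/

/-- The vertices `b p z` with codes `(b, p)` in a given set. -/
def codeSet (x z : Cantor) (C : Set (Start × List (Fin 2))) : Set (Orb x) :=
  {y | ∃ c ∈ C, (y : Cantor) = lab z c}

theorem treeAt_eq_codeSet (x u : Cantor) : treeAt x u = codeSet x u Set.univ := by
  ext y
  constructor
  · rintro ⟨b, p, h⟩
    exact ⟨(b, p), trivial, h⟩
  · rintro ⟨⟨b, p⟩, -, h⟩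
    exact ⟨b, p, h⟩

/-- The codes, relative to `z`, of the tree hanging down and to the left at `110z`. -/
def leftCodes : Set (Start × List (Fin 2)) :=
  {c | (∃ n, c = (.white (n + 1), [])) ∨ ∃ b p, c = (b, p ++ [1])}

theorem leftTreeAt_eq_codeSet (x z : Cantor) : leftTreeAt x z = codeSet x z leftCodes := by
  ext y
  constructor
  · rintro (⟨n, h⟩ | ⟨b, p, h⟩)
    · exact ⟨_, .inl ⟨n, rfl⟩, h⟩
    · refine ⟨_, .inr ⟨b, p, rfl⟩, ?_⟩
      rw [h, lab, Stream'.append_append_stream]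
  · rintro ⟨c, ⟨n, rfl⟩ | ⟨b, p, rfl⟩, h⟩
    · exact .inl ⟨n, h⟩
    · refine .inr ⟨b, p, ?_⟩
      rw [h, lab, Stream'.append_append_stream]

/-- The codes of the black ray at a grey vertex. -/
def rayCodes : Set (Start × List (Fin 2)) := {c | ∃ m, c = (.black m, [])}

/-- Arrows from or into a vertex are computed from any one of its codes, so no injectivity of labels
is needed. `hroot` takes care of the only code whose preimage may have no code. -/
theorem hangsAt_codeSet {x z : Cantor} {C : Set (Start × List (Fin 2))}
    {c₀ : Start × List (Fin 2)} {y : Orb x} (hy : (y : Cantor) = lab z c₀) (hc₀ : c₀ ∈ C)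
    (hout : ∀ s, ∀ c ∈ C, act s c ∈ C ∨ c = c₀)
    (hin : ∀ s c, act s c ∈ C → c ∈ C ∨ act s c = c₀)
    (hroot : (Start.white 0, []) ∈ C → c₀ = (.white 0, [])) :
    (schreier x).HangsAt (codeSet x z C) y := by
  refine ⟨⟨c₀, hc₀, hy⟩, fun s a b h => ⟨?_, ?_⟩⟩
  · rintro ⟨c, hc, ha⟩ hb
    rw [schreier_edge_iff, ha, perm_lab] at h
    rcases hout s c hc with h1 | rfl
    · exact absurd ⟨_, h1, h.symm⟩ hb
    · exact Subtype.ext (ha.trans hy.symm)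
  · rintro ha ⟨c, hc, hb⟩
    refine Subtype.ext (hb.trans (Eq.trans ?_ hy.symm))
    rcases exists_act_eq s c with ⟨d, rfl⟩ | rfl
    · rcases hin s d hc with h1 | h1
      · rw [schreier_edge_iff, hb, ← perm_lab] at h
        exact absurd ⟨d, h1, s.perm.injective h⟩ ha
      · rw [h1]
    · rw [hroot hc]

theorem hangsAt_treeAt {x u : Cantor} {y : Orb x} (hy : (y : Cantor) = [1, 0] ++ₛ u) :
    (schreier x).HangsAt (treeAt x u) y := by
  rw [treeAt_eq_codeSet]
  exact hangsAt_codeSet (c₀ := (.white 0, [])) hy trivial (fun _ _ _ => .inl trivial)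
    (fun _ _ _ => .inl trivial) fun _ => rfl

theorem act_mem_leftCodes (s : Gen) {c : Start × List (Fin 2)} (hc : c ∈ leftCodes) :
    act s c ∈ leftCodes ∨ c = (.white 1, []) := by
  rcases hc with ⟨n, rfl⟩ | ⟨b, p, rfl⟩
  · rcases n with _ | n
    · exact .inr rfl
    · exact .inl (.inl ⟨n, by cases s <;> rfl⟩)
  · refine .inl (.inr ?_)
    cases s
    · rcases b with m | _ | n
      exacts [⟨_, _, rfl⟩, ⟨_, _, rfl⟩, ⟨_, _, rfl⟩]
    · rcases b with m | _ | _ | n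
      exacts [⟨_, _, rfl⟩, ⟨_, 0 :: p, rfl⟩, ⟨_, 1 :: p, rfl⟩, ⟨_, _, rfl⟩]

theorem mem_leftCodes_of_act (s : Gen) {c : Start × List (Fin 2)} (hc : act s c ∈ leftCodes) :
    c ∈ leftCodes := by
  obtain ⟨b, p⟩ := c
  rcases hc with ⟨n, h⟩ | ⟨b', q, h⟩
  · cases s
    · rcases b with m | _ | k
      · simp [act] at h
      · simp [act] at h
      · exact .inl ⟨k, by rw [(Prod.mk.inj h).2]⟩
    · rcases b with m | _ | _ | k
      · simp [act] at h
      · simp [act] at h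
      · simp [act] at h
      · exact .inl ⟨k + 1, by rw [(Prod.mk.inj h).2]⟩
  · cases s
    · refine .inr ⟨b, q, ?_⟩
      rcases b with m | _ | k <;> rw [(Prod.mk.inj h).2]
    · rcases b with m | _ | _ | k
      · exact .inr ⟨_, q, by rw [(Prod.mk.inj h).2]⟩
      · have h2 := (Prod.mk.inj h).2
        rcases q with _ | ⟨a, q⟩
        · simp at h2
        · exact .inr ⟨.white 0, q, by rw [(List.cons.inj h2).2]; rfl⟩
      · have h2 := (Prod.mk.inj h).2
        rcases q with _ | ⟨a, q⟩
        · exact .inl ⟨0, by rw [(List.cons.inj h2).2]⟩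
        · exact .inr ⟨.white 1, q, by rw [(List.cons.inj h2).2]; rfl⟩
      · exact .inr ⟨_, q, by rw [(Prod.mk.inj h).2]⟩

theorem hangsAt_leftTreeAt {x z : Cantor} {y : Orb x} (hy : (y : Cantor) = [1, 1, 0] ++ₛ z) :
    (schreier x).HangsAt (leftTreeAt x z) y := by
  rw [leftTreeAt_eq_codeSet]
  refine hangsAt_codeSet (c₀ := (.white 1, [])) hy (.inl ⟨0, rfl⟩) ?_ ?_ ?_
  · exact fun s c hc => act_mem_leftCodes s hc
  · exact fun s c hc => .inl (mem_leftCodes_of_act s hc)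
  · rintro (⟨n, h⟩ | ⟨b, p, h⟩)
    · simp at h
    · simp at h

theorem hangsAt_rayCodes {x z : Cantor} {y : Orb x} (hy : (y : Cantor) = [0, 1] ++ₛ z) :
    (schreier x).HangsAt (codeSet x z rayCodes) y := by
  refine hangsAt_codeSet (c₀ := (.black 0, [])) hy ⟨0, rfl⟩ ?_ ?_ ?_
  · rintro s c ⟨m, rfl⟩
    cases s
    exacts [.inl ⟨_, rfl⟩, .inl ⟨_, rfl⟩]
  · rintro s ⟨b, p⟩ ⟨m, h⟩
    cases s
    · rcases b with k | _ | n
      · simp only [act, Prod.mk.injEq] at h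
        exact .inl ⟨k, by rw [h.2]⟩
      · simp only [act, Prod.mk.injEq] at h
        exact .inr (by simp only [act, h.2])
      · simp [act] at h
    · rcases b with k | _ | _ | n
      · exact .inl ⟨m, h⟩
      all_goals simp [act] at h
  · rintro ⟨m, h⟩
    simp at h

/-- No coincidences occur among the labels of the vertices with codes in `C` and their images. -/
def Separated (z : Cantor) (C : Set (Start × List (Fin 2))) : Prop :=
  (∀ c ∈ C, ∀ c' ∈ C, lab z c = lab z c' → c = c') ∧
    ∀ s, ∀ c ∈ C, ∀ c' ∈ C, lab z (act s c) = lab z c' → act s c = c'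

theorem NotPeriodic.separated {z : Cantor} (hz : NotPeriodic z) (C : Set (Start × List (Fin 2))) :
    Separated z C :=
  ⟨fun _ _ _ _ => hz.lab_inj, fun _ _ _ _ _ => hz.lab_inj⟩

/-- Here `z` may be purely periodic, as it is on the loop. All words involved are empty or end in
`1`, so a coincidence has the form `r 1 z = z`, and prefixing `1` gives the period `1 r` of `1 z`.
-/
theorem separated_leftCodes {z : Cantor} (hz : NotPeriodic ([1] ++ₛ z)) :
    Separated z leftCodes := by
  have key : ∀ q, q ≠ [] → (∀ a, q.getLast? = some a → a = 1) → q ++ₛ z ≠ z := by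
    intro q hq h1 h
    obtain ⟨r, a, rfl⟩ := (List.eq_nil_or_concat q).resolve_left hq
    rw [List.concat_eq_append] at *
    obtain rfl : a = 1 := h1 a List.getLast?_concat
    rw [Stream'.append_append_stream] at h
    have := hz ([1] ++ r) (by rw [Stream'.append_append_stream, h])
    simp at this
  have inj : ∀ {p p' : List (Fin 2)}, (∀ a, p.getLast? = some a → a = 1) →
      (∀ a, p'.getLast? = some a → a = 1) → p ++ₛ z = p' ++ₛ z → p = p' := by
    intro p p' hp hp' h
    wlog hle : p.length ≤ p'.length generalizing p p'
    · exact (this hp' hp h.symm (le_of_not_ge hle)).symm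
    obtain ⟨q, rfl, hq⟩ := append_eq_append_of_le h hle
    by_cases h0 : q = []
    · rw [h0, List.append_nil]
    · refine absurd hq.symm (key q h0 fun a ha => hp' a ?_)
      rw [List.getLast?_append, ha, Option.some_or]
  have hC : ∀ c ∈ leftCodes, ∀ a, c.2.getLast? = some a → a = 1 := by
    rintro c (⟨n, rfl⟩ | ⟨b, p, rfl⟩) a ha
    · simp at ha
    · rw [List.getLast?_concat, Option.some_inj] at ha
      exact ha.symm
  have hC' : ∀ s, ∀ c ∈ leftCodes, ∀ a, (act s c).2.getLast? = some a → a = 1 := by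
    rintro s c hc a ha
    rcases act_mem_leftCodes s hc with h | rfl
    · exact hC _ h a ha
    · cases s <;> simp [act] at ha
      exact ha.symm
  refine ⟨fun c hc c' hc' h => ?_, fun s c hc c' hc' h => ?_⟩
  · obtain ⟨h1, h2⟩ := start_append_inj h
    exact Prod.ext h1 (inj (hC c hc) (hC c' hc') h2)
  · obtain ⟨h1, h2⟩ := start_append_inj h
    exact Prod.ext h1 (inj (hC' s c hc) (hC c' hc') h2)

/-- Both sides are identified with `C` itself, with the arrows given by `act`. -/
theorem exists_iso_codeSet {x z x' z' : Cantor} {C : Set (Start × List (Fin 2))}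
    (hz : [1, 0] ++ₛ z ∈ MulAction.orbit thompsonF x)
    (hz' : [1, 0] ++ₛ z' ∈ MulAction.orbit thompsonF x')
    (hs : Separated z C) (hs' : Separated z' C) :
    ∃ φ : ((schreier x).induce (codeSet x z C)).Iso ((schreier x').induce (codeSet x' z' C)),
      ∀ (t : codeSet x z C), ∀ c ∈ C, ((t : Orb x) : Cantor) = lab z c →
        (((φ.toEquiv t : codeSet x' z' C) : Orb x') : Cantor) = lab z' c := by
  have main : ∀ {x z : Cantor}, [1, 0] ++ₛ z ∈ MulAction.orbit thompsonF x → Separated z C →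
      ∃ e : C ≃ codeSet x z C, (∀ c, ((e c : Orb x) : Cantor) = lab z c) ∧
        ∀ s c d, (schreier x).edge s (e c) (e d) ↔ act s c = d := by
    intro x z hz hs
    let f : C → codeSet x z C := fun c =>
      ⟨⟨lab z c, (start_mem_orbit_iff _ _).2 hz⟩, c, c.2, rfl⟩
    have hf : Function.Bijective f := by
      constructor
      · intro c d h
        exact Subtype.ext (hs.1 c c.2 d d.2 (congrArg (fun t : codeSet x z C => ((t : Orb x) : Cantor)) h))
      · rintro ⟨y, c, hc, h⟩
        exact ⟨⟨c, hc⟩, Subtype.ext (Subtype.ext h.symm)⟩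
    refine ⟨Equiv.ofBijective f hf, fun c => rfl, fun s c d => ?_⟩
    rw [schreier_edge_iff]
    change s.perm (lab z c) = lab z d ↔ _
    rw [perm_lab]
    exact ⟨hs.2 s c c.2 d d.2, fun h => by rw [h]⟩
  obtain ⟨e, he, hee⟩ := main hz hs
  obtain ⟨e', he', hee'⟩ := main hz' hs'
  refine ⟨⟨e.symm.trans e', fun s a b => ?_⟩, fun t c hc h => ?_⟩
  · have h1 := hee s (e.symm a) (e.symm b)
    rw [e.apply_symm_apply, e.apply_symm_apply] at h1
    exact (hee' s _ _).trans h1.symm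
  · have : t = e ⟨c, hc⟩ := Subtype.ext (Subtype.ext (h.trans (he ⟨c, hc⟩).symm))
    rw [this, Equiv.trans_apply, e.symm_apply_apply, he']

theorem rootedIso_codeSet {x z x' z' : Cantor} {C : Set (Start × List (Fin 2))}
    {c₀ : Start × List (Fin 2)} (hc₀ : c₀ ∈ C) {y : Orb x} {y' : Orb x'}
    (hy : (y : Cantor) = lab z c₀) (hy' : (y' : Cantor) = lab z' c₀)
    (hs : Separated z C) (hs' : Separated z' C) :
    (schreier x).RootedIso (codeSet x z C) y (schreier x') (codeSet x' z' C) y' := by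
  obtain ⟨φ, hφ⟩ := exists_iso_codeSet ((start_mem_orbit_iff c₀.1 c₀.2).1 (hy ▸ y.2))
    ((start_mem_orbit_iff c₀.1 c₀.2).1 (hy' ▸ y'.2)) hs hs'
  exact ⟨⟨c₀, hc₀, hy⟩, ⟨c₀, hc₀, hy'⟩, φ,
    Subtype.ext (Subtype.ext ((hφ _ c₀ hc₀ hy).trans hy'.symm))⟩

/-! ### Geodesic rays -/

/-- The number of leading zeros. -/
noncomputable def leadingZeros (y : Cantor) : ℕ := sInf {n | y.get n = 1}

theorem leadingZeros_one (z : Cantor) : leadingZeros ([1] ++ₛ z) = 0 :=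
  Nat.sInf_eq_zero.2 (.inl rfl)

theorem leadingZeros_replicate (m : ℕ) (z : Cantor) :
    leadingZeros (List.replicate m 0 ++ₛ ([1] ++ₛ z)) = m := by
  refine IsLeast.csInf_eq ⟨?_, fun n hn => ?_⟩
  · have := congrFun (Stream'.drop_append_stream (List.replicate m 0) ([1] ++ₛ z)) 0
    rw [List.length_replicate] at this
    change Stream'.get _ (0 + m) = _ at this
    rwa [zero_add] at this
  · by_contra hlt
    rw [not_le] at hlt
    rw [Set.mem_ofPred_eq, Stream'.get_append_left _ _ _ (by simpa using hlt),
      List.getElem_replicate] at hn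
    exact absurd hn (by decide)

/-- The number of leading zeros of a start. -/
def Start.zeros : Start → ℕ
  | .black m => m + 1
  | .white _ => 0

theorem leadingZeros_start (b : Start) (z : Cantor) : leadingZeros (b.word ++ₛ z) = b.zeros := by
  rcases b with m | m
  · rw [Start.word, Stream'.append_append_stream]
    exact leadingZeros_replicate (m + 1) z
  · exact leadingZeros_one _

theorem zeros_act (s : Gen) (c : Start × List (Fin 2)) :
    (act s c).1.zeros ≤ c.1.zeros + 1 ∧ c.1.zeros ≤ (act s c).1.zeros + 1 := by
  obtain ⟨b, p⟩ := c
  cases s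
  · rcases b with m | _ | n <;> simp [act, Start.zeros]
  · rcases b with m | _ | _ | n <;> simp [act, Start.zeros]

/-- The number of leading zeros is 1-Lipschitz on the graph and grows by one at each step of the
ray. The offset `j` is 1 for rays starting at `01z` and 0 for the ray starting at 1/2. -/
theorem isGeodesicRay_of_replicate {x z : Cantor} (h0 : x ≠ constWord 0) (h1 : x ≠ constWord 1)
    {r : ℕ → Orb x} {j : ℕ}
    (hr : ∀ m, (r m : Cantor) = List.replicate (m + j) 0 ++ₛ ([1] ++ₛ z))
    (hadj : ∀ m, (schreier x).edge .x0 (r m) (r (m + 1))) : (schreier x).IsGeodesicRay r := by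
  have hz : ∀ m, leadingZeros (r m) = m + j := fun m => by rw [hr, leadingZeros_replicate]
  have hstep : ∀ s (a b : Orb x), (schreier x).edge s a b →
      leadingZeros b ≤ leadingZeros a + 1 ∧ leadingZeros a ≤ leadingZeros b + 1 := by
    intro s a b h
    -- Orbit points begin with a start, so `leadingZeros` is never the default value of `sInf ∅`.
    obtain ⟨c, t, ha, -⟩ := exists_start_of_mem_orbit h0 h1 a.2
    rw [schreier_edge_iff, ha] at h
    rw [ha, ← h, leadingZeros_start]
    have h2 := perm_lab s t (c, [])
    change s.perm (c.word ++ₛ t) = (act s (c, [])).1.word ++ₛ _ at h2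
    rw [h2, leadingZeros_start]
    exact zeros_act s (c, [])
  have hwalk : ∀ {a b : Orb x} (p : (schreier x).toSimpleGraph.Walk a b),
      leadingZeros b ≤ leadingZeros a + p.length := by
    intro a b p
    induction p with
    | nil => exact Nat.le_add_right _ _
    | cons h p ih =>
      rw [SimpleGraph.Walk.length_cons]
      obtain ⟨-, ⟨s, h | h⟩ | ⟨s, h | h⟩⟩ := (SimpleGraph.fromRel_adj _ _ _).1 h <;>
        have := hstep s _ _ h <;> omega
  have hex : ∀ m k, ∃ p : (schreier x).toSimpleGraph.Walk (r m) (r (m + k)), p.length = k := by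
    intro m k
    induction k with
    | zero => exact ⟨.nil, rfl⟩
    | succ k ih =>
      obtain ⟨p, hp⟩ := ih
      have hA : (schreier x).toSimpleGraph.Adj (r (m + k)) (r (m + (k + 1))) := by
        refine (SimpleGraph.fromRel_adj _ _ _).2 ⟨fun h => ?_, .inl ⟨.x0, .inl (hadj _)⟩⟩
        have := congrArg (fun y : Orb x => leadingZeros y) h
        simp only [hz] at this
        omega
      exact ⟨p.concat hA, by rw [SimpleGraph.Walk.length_concat, hp]⟩
  refine ⟨fun m => ⟨.x0, .inl (hadj m)⟩, fun m k => ?_⟩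
  obtain ⟨p, hp⟩ := hex m k
  apply le_antisymm ((SimpleGraph.dist_le p).trans_eq hp)
  obtain ⟨q, hq⟩ := p.reachable.exists_walk_length_eq_dist
  have := hwalk q
  rw [hz, hz, hq] at this
  omega

/-! ### The nontrivial loop -/

theorem drop_eq_cons (z : Cantor) (k : ℕ) : z.drop k = [z.get k] ++ₛ z.drop (k + 1) :=
  rayDown_compatible z (k + 1) (z.get k) k rfl

theorem grey_mem_loopLabels_iff {w : List (Fin 2)} {z : Cantor} :
    [1, 0] ++ₛ z ∈ loopLabels w ↔ ∃ i < w.length, z = (periodic w).drop i := by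
  simp only [loopLabels, List.mem_flatMap, List.mem_range]
  refine exists_congr fun i => and_congr_right fun _ => ?_
  have h1 : [1, 0] ++ₛ z ≠ [1, 1, 0] ++ₛ (periodic w).drop (i + 1) := fun h =>
    absurd (congrFun h 1) (show (0 : Fin 2) ≠ 1 by decide)
  have h2 : [1, 0] ++ₛ z = [1, 0] ++ₛ (periodic w).drop i ↔ z = (periodic w).drop i :=
    ⟨fun h => Stream'.append_right_injective _ _ _ h, fun h => by rw [h]⟩
  split_ifs
  · rw [List.mem_singleton, h2]
  · rw [List.mem_cons, List.mem_singleton, h2, or_iff_left h1]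

theorem white_mem_loopLabels {w : List (Fin 2)} (hw : w ≠ []) {i : ℕ}
    (hi : (periodic w).get i = 1) : [1, 1, 0] ++ₛ (periodic w).drop (i + 1) ∈ loopLabels w := by
  have hl : 0 < w.length := List.length_pos_iff.2 hw
  have hlt := Nat.mod_lt i hl
  have h1 : (periodic w).get (i % w.length) = 1 := by
    rw [← hi, periodic_get, periodic_get, Nat.mod_mod]
  have h2 : (periodic w).drop (i % w.length + 1) = (periodic w).drop (i + 1) := by
    rw [← Stream'.drop_drop, periodic_drop_mod, Stream'.drop_drop]
  simp only [loopLabels, List.mem_flatMap, List.mem_range]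
  refine ⟨i % w.length, hlt, ?_⟩
  rw [h1, if_neg (by decide), h2]
  exact List.mem_cons_of_mem _ (List.mem_singleton_self _)

theorem loopLabels_nodup {w : List (Fin 2)} (hw : IsPrimitive w) : (loopLabels w).Nodup := by
  have hgw : ∀ z z' : Cantor, [1, 0] ++ₛ z ≠ [1, 1, 0] ++ₛ z' := fun z z' h =>
    absurd (congrFun h 1) (show (0 : Fin 2) ≠ 1 by decide)
  refine List.nodup_flatMap.2 ⟨fun i _ => ?_, ?_⟩
  · split_ifs
    · exact List.nodup_singleton _
    · exact List.nodup_cons.2 ⟨by simpa using hgw _ _, List.nodup_singleton _⟩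
  · refine List.Pairwise.imp_of_mem ?_ List.nodup_range
    intro i j hi hj hij y hy hy'
    rw [List.mem_range] at hi hj
    have hg : [1, 0] ++ₛ (periodic w).drop i ≠ [1, 0] ++ₛ (periodic w).drop j := fun h =>
      hij (periodic_drop_inj hw hi hj (Stream'.append_right_injective _ _ _ h))
    have hmem : ∀ {k}, y ∈ (if (periodic w).get k = 0 then [[1, 0] ++ₛ (periodic w).drop k]
        else [[1, 0] ++ₛ (periodic w).drop k, [1, 1, 0] ++ₛ (periodic w).drop (k + 1)]) →
        y = [1, 0] ++ₛ (periodic w).drop k ∨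
        ((periodic w).get k = 1 ∧ y = [1, 1, 0] ++ₛ (periodic w).drop (k + 1)) := by
      intro k h
      split_ifs at h with h0
      · exact .inl (List.mem_singleton.1 h)
      · rw [List.mem_cons, List.mem_singleton] at h
        exact h.imp_right fun h => ⟨by omega, h⟩
    rcases hmem hy with h | ⟨h1, h⟩ <;> rcases hmem hy' with h' | ⟨h1', h'⟩
    · exact hg (h.symm.trans h')
    · exact hgw _ _ (h.symm.trans h')
    · exact hgw _ _ (h'.symm.trans h)
    -- Two equal white labels: the letter before both shifts is `1`, so the shifts one place earlier
    -- agree too.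
    · have h2 := Stream'.append_right_injective _ _ _ (h.symm.trans h')
      apply hij
      apply periodic_drop_inj hw hi hj
      rw [drop_eq_cons, h2, h1, ← h1', ← drop_eq_cons]

/-- Two points are joined by an arrow. -/
def JoinedByArrow (y y' : Cantor) : Prop := ∃ s : Gen, s.perm y = y' ∨ s.perm y' = y

/-- The chain ends with the next grey vertex so that induction on `n` works; for `P = w^∞` and `n =
|w|` this vertex is the first one again, which closes the loop. -/
theorem loop_isChain (P : Cantor) (n : ℕ) :
    List.IsChain JoinedByArrow (((List.range n).flatMap fun i =>
      if P.get i = 0 then [[1, 0] ++ₛ P.drop i]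
      else [[1, 0] ++ₛ P.drop i, [1, 1, 0] ++ₛ P.drop (i + 1)]) ++ [[1, 0] ++ₛ P.drop n]) := by
  induction n with
  | zero => exact List.isChain_singleton _
  | succ n ih =>
    rw [List.range_succ, List.flatMap_append, List.flatMap_singleton]
    split_ifs with h
    · rw [List.append_assoc, List.singleton_append, List.isChain_split]
      refine ⟨ih, List.isChain_pair.2 ⟨.x1, .inr ?_⟩⟩
      rw [drop_eq_cons P n, h]
      exact x1Fun_one_zero _
    · rw [List.append_assoc, List.cons_append, List.isChain_split]
      have h1 : P.get n = 1 := by omega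
      refine ⟨ih, List.isChain_cons_cons.2 ⟨⟨.x1, .inr ?_⟩, List.isChain_pair.2 ⟨.x0, .inl ?_⟩⟩⟩
      · rw [drop_eq_cons P n, h1]
        exact x1Fun_one_one_zero _
      · exact x0Fun_one_one _

theorem loopLabels_take_one {w : List (Fin 2)} (hw : w ≠ []) :
    (loopLabels w).take 1 = [[1, 0] ++ₛ (periodic w).drop w.length] := by
  obtain ⟨n, hn⟩ : ∃ n, w.length = n + 1 :=
    Nat.exists_eq_succ_of_ne_zero (List.length_pos_iff.2 hw).ne'
  rw [← periodic_drop_mod, Nat.mod_self, Stream'.drop_zero, loopLabels, hn,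
    List.range_succ_eq_map, List.flatMap_cons]
  split_ifs <;> rfl

theorem exists_loop {x : Cantor} {w : List (Fin 2)} (hw : IsPrimitive w)
    (hmem : ∀ y ∈ loopLabels w, y ∈ MulAction.orbit thompsonF x) :
    ∃ l : List (Orb x), l.map Subtype.val = loopLabels w ∧ l.Nodup ∧
      List.IsChain (schreier x).Adj (l ++ l.take 1) := by
  obtain ⟨l, hl⟩ : ∃ l : List (Orb x), l.map Subtype.val = loopLabels w :=
    ⟨(loopLabels w).attach.map fun y => ⟨y.1, hmem y.1 y.2⟩, by
      rw [List.map_map]; exact List.attach_map_subtype_val _⟩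
  refine ⟨l, hl, List.Nodup.of_map _ (hl ▸ loopLabels_nodup hw), ?_⟩
  refine List.isChain_of_isChain_map (S := JoinedByArrow) Subtype.val ?_ ?_
  · rintro a b ⟨s, h | h⟩
    exacts [⟨s, .inl (schreier_edge_iff.2 h)⟩, ⟨s, .inr (schreier_edge_iff.2 h)⟩]
  · rw [List.map_append, List.map_take, hl, loopLabels_take_one hw.1]
    exact loop_isChain _ _

theorem ncard_grey_loopSet {x : Cantor} {w : List (Fin 2)} (hw : IsPrimitive w)
    (hmem : ∀ y ∈ loopLabels w, y ∈ MulAction.orbit thompsonF x) :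
    {y : Orb x | y ∈ loopSet x w ∧ IsGrey y}.ncard = w.length := by
  have hi : ∀ i < w.length, [1, 0] ++ₛ (periodic w).drop i ∈ loopLabels w := fun i hi =>
    grey_mem_loopLabels_iff.2 ⟨i, hi, rfl⟩
  let f : Fin w.length → Orb x := fun i => ⟨_, hmem _ (hi i i.2)⟩
  have hf : Function.Injective f := fun i j h => Fin.ext (periodic_drop_inj hw i.2 j.2
    (Stream'.append_right_injective _ _ _ (congrArg Subtype.val h)))
  have : {y : Orb x | y ∈ loopSet x w ∧ IsGrey y} = Set.range f := by
    ext y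
    constructor
    · rintro ⟨h, z, hz⟩
      change (y : Cantor) ∈ loopLabels w at h
      rw [hz] at h
      obtain ⟨i, hi, rfl⟩ := grey_mem_loopLabels_iff.1 h
      exact ⟨⟨i, hi⟩, Subtype.ext hz.symm⟩
    · rintro ⟨i, rfl⟩
      exact ⟨hi i i.2, _, rfl⟩
  rw [this, ← Set.image_univ, Set.ncard_image_of_injective _ hf, Set.ncard_univ, Nat.card_fin]

/-- The neighbours of a grey vertex. -/
theorem adj_grey {x z : Cantor} {g y : Orb x} (hg : (g : Cantor) = [1, 0] ++ₛ z)
    (h : (schreier x).Adj g y) :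
    (y : Cantor) = [0, 1] ++ₛ z ∨ (y : Cantor) = [1, 1, 0] ++ₛ z ∨
      (y : Cantor) = [1, 0, 0] ++ₛ z ∨ (z.get 0 = 0 ∧ (y : Cantor) = [1, 0] ++ₛ z.drop 1) ∨
      (z.get 0 = 1 ∧ (y : Cantor) = [1, 1, 0] ++ₛ z.drop 1) := by
  obtain ⟨s, h | h⟩ := h
  · rw [schreier_edge_iff, hg] at h
    cases s
    · exact .inl (h.symm.trans (x0Fun_one_zero z))
    · exact .inr (.inr (.inl (h.symm.trans (x1Fun_one_zero z))))
  · rw [schreier_edge_iff, hg] at h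
    cases s
    · exact .inr (.inl (x0Perm.injective (h.trans (x0Fun_one_one _).symm)))
    -- The `x₁`-arrow into `10z` comes from one step up, so its source depends on the first letter
    -- of `z`.
    · have hz := drop_eq_cons z 0
      rw [Stream'.drop_zero] at hz
      match h0 : z.get 0 with
      | 0 =>
        rw [h0] at hz
        refine .inr (.inr (.inr (.inl ⟨rfl, x1Perm.injective (h.trans ?_)⟩)))
        conv_lhs => rw [hz]
        exact (x1Fun_one_zero _).symm
      | 1 =>
        rw [h0] at hz
        refine .inr (.inr (.inr (.inr ⟨rfl, x1Perm.injective (h.trans ?_)⟩)))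
        conv_lhs => rw [hz]
        exact (x1Fun_one_one_zero _).symm

/-! ### The Schreier graph of a rational point -/

theorem grey_drop_mem {x z : Cantor} (h : [1, 0] ++ₛ z ∈ MulAction.orbit thompsonF x) (k : ℕ) :
    [1, 0] ++ₛ z.drop k ∈ MulAction.orbit thompsonF x := by
  rw [← start_mem_orbit_iff (.white 0) (z.take k), Stream'.append_take_drop]
  exact h

theorem loopLabels_mem_orbit {x : Cantor} {w : List (Fin 2)}
    (h : [1, 0] ++ₛ periodic w ∈ MulAction.orbit thompsonF x) :
    ∀ y ∈ loopLabels w, y ∈ MulAction.orbit thompsonF x := by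
  intro y hy
  simp only [loopLabels, List.mem_flatMap, List.mem_range] at hy
  obtain ⟨i, -, hy⟩ := hy
  split_ifs at hy
  · rw [List.mem_singleton.1 hy]
    exact grey_drop_mem h i
  · rw [List.mem_cons, List.mem_singleton] at hy
    rcases hy with rfl | rfl
    · exact grey_drop_mem h i
    · exact (start_mem_orbit_iff (.white 1) []).2 (grey_drop_mem h (i + 1))

theorem IsNormalForm.grey_mem {x : Cantor} {a : Start} {v w : List (Fin 2)}
    (h : IsNormalForm x a v w) :
    [1, 0] ++ₛ (v ++ₛ periodic w) ∈ MulAction.orbit thompsonF x := by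
  refine (start_mem_orbit_iff a []).1 ?_
  rw [Stream'.nil_append_stream, ← h.1]
  exact MulAction.mem_orbit_self x

theorem IsNormalForm.grey_periodic_mem {x : Cantor} {a : Start} {v w : List (Fin 2)}
    (h : IsNormalForm x a v w) : [1, 0] ++ₛ periodic w ∈ MulAction.orbit thompsonF x :=
  (start_mem_orbit_iff (.white 0) v).1 h.grey_mem

theorem IsNormalForm.tailEq {x : Cantor} {a : Start} {v w : List (Fin 2)}
    (h : IsNormalForm x a v w) : TailEq x (periodic w) :=
  ⟨a.word.length + v.length, 0, by
    rw [h.1, drop_append_add, Stream'.drop_append_stream, Stream'.drop_zero]⟩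

theorem half_ne_const (a : Fin 2) : half ≠ constWord a := fun h => by
  have h0 := congrFun h 0
  have h1 := congrFun h 1
  exact absurd (h0.trans h1.symm) (show (1 : Fin 2) ≠ 0 by decide)

theorem grey_half_mem : [1, 0] ++ₛ half ∈ MulAction.orbit thompsonF half := by
  refine (start_mem_orbit_iff (.white 0) [1]).2 ?_
  convert MulAction.mem_orbit_self (M := thompsonF) half using 1
  exact funext fun n => by rcases n with _ | _ | n <;> rfl

theorem grey_zero_mem : [1, 0] ++ₛ constWord 0 ∈ MulAction.orbit thompsonF half :=
  (start_mem_orbit_iff (.white 0) [1]).1 grey_half_mem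

theorem existsUnique_normalForm {x : Cantor} (hx : IsRational x)
    (hx0 : x ≠ constWord 0) (hx1 : x ≠ constWord 1) :
    ∃! q : Start × List (Fin 2) × List (Fin 2), IsNormalForm x q.1 q.2.1 q.2.2 := by
  obtain ⟨b, u, hu⟩ := exists_start x hx0 hx1
  have hur : IsRational u := by
    obtain ⟨k, p, hp, h⟩ := hx
    refine ⟨k, p, hp, ?_⟩
    have h2 := congrArg (Stream'.drop b.word.length) h
    rw [Stream'.drop_drop, Stream'.drop_drop, hu, add_comm k b.word.length, add_comm (k + p),
      drop_append_add, drop_append_add] at h2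
    exact h2
  obtain ⟨v, w, rfl, hw, hv⟩ := exists_normalForm hur
  refine ⟨(b, v, w), ⟨hu, hw, hv⟩, ?_⟩
  rintro ⟨b', v', w'⟩ ⟨h1, h2, h3⟩
  obtain ⟨rfl, h⟩ := start_append_inj (h1.symm.trans hu)
  obtain ⟨rfl, rfl⟩ := normalForm_unique h2 hw h3 hv h
  rfl

section NormalForm

variable {x : Cantor} {a : Start} {v w : List (Fin 2)}

theorem exists_iso_typeB (hx0 : x ≠ constWord 0) (hx1 : x ≠ constWord 1)
    (h : IsNormalForm x a v w) :
    ∃ φ : ((typeB (v ++ₛ periodic w)).glue (typeBLabel (v ++ₛ periodic w))).Iso (schreier x),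
      (∀ t, ((φ.toEquiv (Quotient.mk _ t) : Orb x) : Cantor)
        = typeBLabel (v ++ₛ periodic w) t) ∧
      φ.toEquiv (Quotient.mk _ (typeBBase (v ++ₛ periodic w) a)) = basePt x := by
  have hL := rayDown_compatible (v ++ₛ periodic w)
  obtain ⟨φ, hφ⟩ := exists_glue_iso (Γ := typeB (v ++ₛ periodic w))
    (l := typeBLabel (v ++ₛ periodic w)) (x := x)
    (fun t => (start_mem_orbit_iff _ _).2 (grey_drop_mem h.grey_mem _))
    (fun y hy => by
      obtain ⟨b, t, rfl, m, k, ht⟩ := exists_start_of_mem_orbit hx0 hx1 hy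
      -- Dropping `|a|` further letters turns the common tail with `x = a u` into a shift of `u`.
      refine hL.exists_spineLab_eq (u := v ++ₛ periodic w) (m := a.word.length + m) (i := k) rfl ?_
      rw [add_comm, ← Stream'.drop_drop, ht, h.1, Stream'.drop_drop, add_comm, drop_append_add])
    hL.edge spineGraph_exists_edge
  exact ⟨φ, hφ, Subtype.ext ((hφ _).trans h.1.symm)⟩

theorem exists_iso_loopGraph (hx0 : x ≠ constWord 0) (hx1 : x ≠ constWord 1)
    (h : IsNormalForm x a v w) :
    ∃ φ : (loopGraph w).Iso (schreier x),
      (∀ t, ((φ.toEquiv t : Orb x) : Cantor)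
        = t.2.word ++ₛ (t.1.1.2 ++ₛ (periodic w).drop t.1.1.1)) ∧
      ∃ c : Grey (cycleDown w), c.1.1.val = 0 ∧ c.1.2 = v ∧ φ.toEquiv (c, a) = basePt x := by
  have hL := cycleDown_compatible w
  have hl : 0 < w.length := List.length_pos_iff.2 h.2.1.1
  obtain ⟨φ, hφ⟩ := exists_iso (Γ := loopGraph w)
    (l := spineLab (down := cycleDown w) fun i => (periodic w).drop i) (x := x)
    (fun t => (start_mem_orbit_iff _ _).2 (grey_drop_mem h.grey_periodic_mem _))
    (fun y hy => by
      obtain ⟨b, t, rfl, ht⟩ := exists_start_of_mem_orbit hx0 hx1 hy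
      obtain ⟨m, k, ht⟩ := ht.trans h.tailEq
      exact hL.exists_spineLab_eq (u := periodic w) (i := ⟨k % w.length, Nat.mod_lt _ hl⟩)
        (periodic_drop_mod w k) ht)
    hL.edge spineGraph_exists_edge (cycle_spineLab_injective h.2.1)
  refine ⟨φ, hφ, ⟨(⟨0, hl⟩, v), ?_⟩, rfl, rfl, Subtype.ext ((hφ _).trans h.1.symm)⟩
  -- Below the spine vertex `0` is `|w| - 1`, so reducedness of `(0, v)` is exactly the condition on
  -- the last letters of `v` and `w`.
  intro b j hb
  simp only [cycleDown, Option.some_inj, Prod.mk.injEq] at hb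
  rw [← hb.1]
  intro hv
  apply h.2.2
  rw [hv, List.getLast?_eq_getElem?, List.get_eq_getElem, ← List.getElem?_eq_getElem]
  congr 1
  change (0 + (w.length - 1)) % w.length = w.length - 1
  rw [zero_add, Nat.mod_eq_of_lt (by omega)]

theorem notPeriodic_of_mem_orbit (hx0 : x ≠ constWord 0) (hx1 : x ≠ constWord 1)
    (h : IsNormalForm x a v w) {u : Cantor} (hu : [1, 0] ++ₛ u ∈ MulAction.orbit thompsonF x)
    (hne : ∀ i, u ≠ (periodic w).drop i) : NotPeriodic u := by
  obtain ⟨b, t, hb, ht⟩ := exists_start_of_mem_orbit hx0 hx1 hu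
  obtain ⟨-, rfl⟩ := start_append_inj (b := .white 0) hb
  exact notPeriodic_of_tailEq (ht.trans h.tailEq) hne

theorem exists_iso_treeAt {u : Cantor} (hu : [1, 0] ++ₛ u ∈ MulAction.orbit thompsonF x)
    (hne : NotPeriodic u) :
    ∃ φ : ((schreier x).induce (treeAt x u)).Iso ((schreier half).induce (treeAt half half)),
      ∀ (t : treeAt x u) (b : Start) (p : List (Fin 2)),
        ((t : Orb x) : Cantor) = b.word ++ₛ (p ++ₛ u) →
        (((φ.toEquiv t : treeAt half half) : Orb half) : Cantor) = b.word ++ₛ (p ++ₛ half) := by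
  rw [treeAt_eq_codeSet, treeAt_eq_codeSet]
  obtain ⟨φ, hφ⟩ := exists_iso_codeSet hu grey_half_mem (hne.separated Set.univ)
    ((notPeriodic_append_half []).separated _)
  exact ⟨φ, fun t b p ht => hφ t (b, p) trivial ht⟩

theorem exists_path (h : IsNormalForm x a v w) :
    ∃ g : ℕ → Orb x,
      (∀ k, (g k : Cantor) = [1, 0] ++ₛ (v ++ₛ periodic w).drop k) ∧
      (∀ (k : ℕ) (hk : k < (v ++ w).length), k + 1 < (v ++ w).length →
        StepUp ((v ++ w)[k]) (g k) (g (k + 1))) ∧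
      Set.InjOn g {k | k < (v ++ w).length} ∧
      (w.getLast? = some 0 →
        (schreier x).edge .x1 (g v.length) (g (v.length + (w.length - 1)))) ∧
      (w.getLast? = some 1 →
        ∃ t : Orb x, (t : Cantor) = [1, 1, 0] ++ₛ periodic w ∧
          (schreier x).edge .x0 t (g v.length) ∧
          (schreier x).edge .x1 t (g (v.length + (w.length - 1)))) := by
  set u := v ++ₛ periodic w with hu
  let g : ℕ → Orb x := fun k => ⟨_, grey_drop_mem h.grey_mem k⟩
  have hl : 0 < w.length := List.length_pos_iff.2 h.2.1.1
  have hg0 : (g v.length : Cantor) = [1, 0] ++ₛ periodic w :=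
    congrArg (Stream'.appendStream' [1, 0]) (Stream'.drop_append_stream _ _)
  have hlast : ∀ b, w.getLast? = some b →
      (g (v.length + (w.length - 1)) : Cantor) = [1, 0] ++ₛ ([b] ++ₛ periodic w) := by
    intro b hb
    rw [List.getLast?_eq_getElem?, List.getElem?_eq_getElem (by omega), Option.some_inj] at hb
    refine congrArg (Stream'.appendStream' [1, 0]) ?_
    rw [drop_append_add, drop_eq_cons, periodic_get_of_lt (by omega), hb,
      show w.length - 1 + 1 = w.length by omega, ← periodic_drop_mod w w.length, Nat.mod_self,
      Stream'.drop_zero]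
  refine ⟨g, fun k => rfl, fun k hk _ => ⟨⟨_, rfl⟩, ⟨_, rfl⟩, ?_⟩, ?_, fun hb => ?_, fun hb => ?_⟩
  · have hk' : u.get k = (v ++ w)[k] := by
      rw [hu, ← append_periodic w, ← Stream'.append_append_stream, Stream'.get_append_left _ _ _ hk]
    have hd := drop_eq_cons u k
    rw [hk'] at hd
    generalize (v ++ w)[k] = b at hd
    match b with
    | 0 =>
      refine .inl ⟨rfl, schreier_edge_iff.2 ?_⟩
      exact (x1Fun_one_zero _).trans (congrArg (Stream'.appendStream' [1, 0]) hd.symm)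
    | 1 =>
      refine .inr ⟨rfl, ⟨_, (start_mem_orbit_iff (.white 1) []).2
        (grey_drop_mem h.grey_mem (k + 1))⟩, ⟨_, rfl⟩, schreier_edge_iff.2 ?_,
        schreier_edge_iff.2 ?_⟩
      · exact x0Fun_one_one _
      · exact (x1Fun_one_one_zero _).trans (congrArg (Stream'.appendStream' [1, 0]) hd.symm)
  -- Equal vertices at `i < j` force `|v| ≤ i` and `|w| ∣ j - i`, so `j ≥ |v| + |w|`.
  · have key : ∀ i j, j < (v ++ w).length → i < j → g i ≠ g j := by
      intro i j hj hij heq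
      obtain ⟨d, rfl⟩ := Nat.exists_eq_add_of_lt hij
      have h1 := drop_eq_imp h.2.1 h.2.2 (Nat.succ_pos d)
        (Stream'.append_right_injective _ _ _ (congrArg Subtype.val heq)).symm
      have h2 := Nat.le_of_dvd (Nat.succ_pos d) h1.2
      rw [List.length_append] at hj
      omega
    intro i hi j hj heq
    rcases lt_trichotomy i j with hlt | rfl | hlt
    · exact absurd heq (key i j hj hlt)
    · rfl
    · exact absurd heq.symm (key j i hi hlt)
  · rw [schreier_edge_iff, hg0, hlast 0 hb]
    exact x1Fun_one_zero _
  · refine ⟨⟨_, (start_mem_orbit_iff (.white 1) []).2 h.grey_periodic_mem⟩, rfl, ?_, ?_⟩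
    · rw [schreier_edge_iff, hg0]
      exact x0Fun_one_one _
    · rw [schreier_edge_iff, hlast 1 hb]
      exact x1Fun_one_one_zero _

theorem exists_black_ray (hx0 : x ≠ constWord 0) (hx1 : x ≠ constWord 1) {y : Orb x} {z : Cantor}
    (hy : (y : Cantor) = [0, 1] ++ₛ z) :
    ∃ (r : ℕ → Orb x) (r' : ℕ → Orb half), r 0 = y ∧
      (∀ m, (r m : Cantor) = (Start.black m).word ++ₛ z) ∧
      (∀ m, (r' m : Cantor) = List.replicate m 0 ++ₛ half) ∧
      (schreier x).IsGeodesicRay r ∧ (schreier half).IsGeodesicRay r' ∧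
      (∀ s m n, (schreier x).edge s (r m) (r n) ↔ (schreier half).edge s (r' m) (r' n)) ∧
      (schreier x).HangsAt (Set.range r) y := by
  have hz : [1, 0] ++ₛ z ∈ MulAction.orbit thompsonF x :=
    (start_mem_orbit_iff (.black 0) []).1 (hy ▸ y.2 : [0, 1] ++ₛ z ∈ _)
  let r : ℕ → Orb x := fun m => ⟨_, (start_mem_orbit_iff (.black m) []).2 hz⟩
  have hr' : ∀ m, List.replicate m 0 ++ₛ half ∈ MulAction.orbit thompsonF half := by
    intro m
    rcases m with _ | m
    · exact MulAction.mem_orbit_self _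
    · have := (start_mem_orbit_iff (.black m) []).2 grey_zero_mem
      rw [Start.word, Stream'.append_append_stream] at this
      exact this
  let r' : ℕ → Orb half := fun m => ⟨_, hr' m⟩
  have hrep : ∀ m, (r m : Cantor) = List.replicate (m + 1) 0 ++ₛ ([1] ++ₛ z) := fun m =>
    Stream'.append_append_stream _ _ _
  have hrep' : ∀ m, (r' m : Cantor) = List.replicate (m + 0) 0 ++ₛ ([1] ++ₛ constWord 0) :=
    fun m => rfl
  have hs : ∀ (s : Gen) m, s.perm (r m : Cantor) = r (match s with | .x0 => m + 1 | .x1 => m) := by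
    intro s m
    cases s
    exacts [perm_lab .x0 z (.black m, []), perm_lab .x1 z (.black m, [])]
  have hs' : ∀ (s : Gen) m, s.perm (r' m : Cantor) = r' (match s with | .x0 => m + 1 | .x1 => m) := by
    intro s m
    -- The point 1/2 is not black; `x₁` fixes it only because its tail is `0^∞`.
    rcases m with _ | m
    · cases s <;> exact funext fun n => by rcases n with _ | _ | _ | n <;> rfl
    · cases s
      exacts [x0Fun_zero _, x1Fun_zero _]
  have hinj : ∀ m n, (r m : Cantor) = r n ↔ m = n := fun m n =>
    ⟨fun h => by
      have := congrArg leadingZeros h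
      rw [hrep, hrep, leadingZeros_replicate, leadingZeros_replicate] at this
      omega, fun h => by rw [h]⟩
  have hinj' : ∀ m n, (r' m : Cantor) = r' n ↔ m = n := fun m n =>
    ⟨fun h => by
      have := congrArg leadingZeros h
      rw [hrep', hrep', leadingZeros_replicate, leadingZeros_replicate] at this
      omega, fun h => by rw [h]⟩
  refine ⟨r, r', Subtype.ext hy.symm, fun m => rfl, fun m => rfl,
    isGeodesicRay_of_replicate hx0 hx1 hrep fun m => schreier_edge_iff.2 (hs .x0 m),
    isGeodesicRay_of_replicate (half_ne_const 0) (half_ne_const 1) hrep'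
      fun m => schreier_edge_iff.2 (hs' .x0 m), fun s m n => ?_, ?_⟩
  · rw [schreier_edge_iff, schreier_edge_iff, hs, hs', hinj, hinj']
  · have : Set.range r = codeSet x z rayCodes := by
      ext y
      constructor
      · rintro ⟨m, rfl⟩
        exact ⟨_, ⟨m, rfl⟩, rfl⟩
      · rintro ⟨_, ⟨m, rfl⟩, h⟩
        exact ⟨m, Subtype.ext h.symm⟩
    rw [this]
    exact hangsAt_rayCodes hy

/-- The comparison tail in the orbit of 1/2 is `0^∞`: it is periodic itself, but `1 0^∞` is not,
which is all that the left tree needs. -/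
theorem rootedIso_leftTreeAt {y : Orb x} {z : Cantor} (hy : (y : Cantor) = [1, 1, 0] ++ₛ z)
    (hz : NotPeriodic ([1] ++ₛ z)) :
    ∃ t : Orb half, (t : Cantor) = [1, 1] ++ₛ constWord 0 ∧
      (schreier x).RootedIso (leftTreeAt x z) y
        (schreier half) (leftTreeAt half (constWord 0)) t := by
  have h0 : [1, 1, 0] ++ₛ constWord 0 = [1, 1] ++ₛ constWord 0 :=
    funext fun n => by rcases n with _ | _ | _ | n <;> rfl
  refine ⟨⟨_, (start_mem_orbit_iff (.white 1) []).2 grey_zero_mem⟩, h0, ?_⟩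
  rw [leftTreeAt_eq_codeSet, leftTreeAt_eq_codeSet]
  exact rootedIso_codeSet (c₀ := (.white 1, [])) (.inl ⟨0, rfl⟩) hy rfl (separated_leftCodes hz)
    (separated_leftCodes (notPeriodic_append_half []))

theorem rootedIso_rightTreeAt {y : Orb x} {z : Cantor} (hy : (y : Cantor) = [1, 0, 0] ++ₛ z)
    (hz : NotPeriodic ([0] ++ₛ z)) :
    ∃ t : Orb half, (t : Cantor) = [1, 0, 0] ++ₛ half ∧
      (schreier x).RootedIso (treeAt x ([0] ++ₛ z)) y
        (schreier half) (treeAt half ([0] ++ₛ half)) t := by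
  refine ⟨⟨_, (start_mem_orbit_iff (.white 0) [0]).2 grey_half_mem⟩, rfl, ?_⟩
  rw [treeAt_eq_codeSet, treeAt_eq_codeSet]
  exact rootedIso_codeSet (C := Set.univ) (c₀ := (.white 0, [])) trivial hy rfl (hz.separated _)
    ((notPeriodic_append_half [0]).separated _)

end NormalForm

/-! ### The main theorem. -/

theorem mainTheorem3 (x : Cantor) (hx : IsRational x)
    (hx0 : x ≠ constWord 0) (hx1 : x ≠ constWord 1) :
    -- existence and uniqueness of the normal form
    (∃! q : Start × List (Fin 2) × List (Fin 2), IsNormalForm x q.1 q.2.1 q.2.2) ∧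
    ∀ (a : Start) (v w : List (Fin 2)), IsNormalForm x a v w →
      -- the Schreier graph is the limit graph of type B with vertices of equal label glued
      (∃ φ : ((typeB (v ++ₛ periodic w)).glue (typeBLabel (v ++ₛ periodic w))).Iso (schreier x),
        (∀ t, ((φ.toEquiv (Quotient.mk _ t) : Orb x) : Cantor)
          = typeBLabel (v ++ₛ periodic w) t) ∧
        φ.toEquiv (Quotient.mk _ (typeBBase (v ++ₛ periodic w) a)) = basePt x) ∧
      -- explicitly, it is one loop with `|w|` grey vertices and with trees attached
      (∃ φ : (loopGraph w).Iso (schreier x),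
        (∀ t, ((φ.toEquiv t : Orb x) : Cantor)
          = t.2.word ++ₛ (t.1.1.2 ++ₛ (periodic w).drop t.1.1.1)) ∧
        ∃ c : Grey (cycleDown w), c.1.1.val = 0 ∧ c.1.2 = v ∧ φ.toEquiv (c, a) = basePt x) ∧
      -- trees hanging from the grey vertices outside the loop
      (∀ (y : Orb x) (u : Cantor), (y : Cantor) = [1, 0] ++ₛ u →
        (∀ i : ℕ, u ≠ (periodic w).drop i) →
        (schreier x).HangsAt (treeAt x u) y ∧
        ∃ φ : ((schreier x).induce (treeAt x u)).Iso ((schreier half).induce (treeAt half half)),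
          ∀ (t : treeAt x u) (b : Start) (p : List (Fin 2)),
            ((t : Orb x) : Cantor) = b.word ++ₛ (p ++ₛ u) →
            (((φ.toEquiv t : treeAt half half) : Orb half) : Cantor) = b.word ++ₛ (p ++ₛ half)) ∧
      -- the path going up, and the loop
      (∃ g : ℕ → Orb x,
        (∀ k, (g k : Cantor) = [1, 0] ++ₛ (v ++ₛ periodic w).drop k) ∧
        (∀ (k : ℕ) (hk : k < (v ++ w).length), k + 1 < (v ++ w).length →
          StepUp ((v ++ w)[k]) (g k) (g (k + 1))) ∧
        Set.InjOn g {k | k < (v ++ w).length} ∧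
        (w.getLast? = some 0 →
          (schreier x).edge .x1 (g v.length) (g (v.length + (w.length - 1)))) ∧
        (w.getLast? = some 1 →
          ∃ t : Orb x, (t : Cantor) = [1, 1, 0] ++ₛ periodic w ∧
            (schreier x).edge .x0 t (g v.length) ∧
            (schreier x).edge .x1 t (g (v.length + (w.length - 1))))) ∧
      (∃ l : List (Orb x), l.map Subtype.val = loopLabels w ∧ l.Nodup ∧
        List.IsChain (schreier x).Adj (l ++ l.take 1)) ∧
      {y : Orb x | y ∈ loopSet x w ∧ IsGrey y}.ncard = w.length ∧
      -- what is attached to the grey vertices of the loop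
      (∀ (g y : Orb x) (z : Cantor), g ∈ loopSet x w → (g : Cantor) = [1, 0] ++ₛ z →
        (schreier x).Adj g y → y ∉ loopSet x w →
        -- a geodesic isomorphic to the geodesic `1, 01, 001, …` of `1/2`
        (∃ (r : ℕ → Orb x) (r' : ℕ → Orb half), r 0 = y ∧
          (∀ m, (r m : Cantor) = (Start.black m).word ++ₛ z) ∧
          (∀ m, (r' m : Cantor) = List.replicate m 0 ++ₛ half) ∧
          (schreier x).IsGeodesicRay r ∧ (schreier half).IsGeodesicRay r' ∧
          (∀ s m n, (schreier x).edge s (r m) (r n) ↔ (schreier half).edge s (r' m) (r' n)) ∧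
          (schreier x).HangsAt (Set.range r) y) ∨
        -- the tree hanging down and to the left at the vertex `11` of `1/2`
        ((y : Cantor) = [1, 1, 0] ++ₛ z ∧
          (schreier x).HangsAt (leftTreeAt x z) y ∧
          ∃ t : Orb half, (t : Cantor) = [1, 1] ++ₛ constWord 0 ∧
            (schreier x).RootedIso (leftTreeAt x z) y
              (schreier half) (leftTreeAt half (constWord 0)) t) ∨
        -- the tree hanging down and to the right at the vertex `101` of `1/2`
        ((y : Cantor) = [1, 0, 0] ++ₛ z ∧
          (schreier x).HangsAt (treeAt x ([0] ++ₛ z)) y ∧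
          ∃ t : Orb half, (t : Cantor) = [1, 0, 0] ++ₛ half ∧
            (schreier x).RootedIso (treeAt x ([0] ++ₛ z)) y
              (schreier half) (treeAt half ([0] ++ₛ half)) t)) := by
  refine ⟨existsUnique_normalForm hx hx0 hx1, fun a v w h => ⟨exists_iso_typeB hx0 hx1 h,
    exists_iso_loopGraph hx0 hx1 h, fun y u hy hne => ⟨hangsAt_treeAt hy, exists_iso_treeAt
      (hy ▸ y.2) (notPeriodic_of_mem_orbit hx0 hx1 h (hy ▸ y.2) hne)⟩, exists_path h,
    exists_loop h.2.1 (loopLabels_mem_orbit h.grey_periodic_mem),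
    ncard_grey_loopSet h.2.1 (loopLabels_mem_orbit h.grey_periodic_mem), ?_⟩⟩
  intro g y z hg hgz hadj hy
  change (g : Cantor) ∈ loopLabels w at hg
  change ¬ (y : Cantor) ∈ loopLabels w at hy
  rw [hgz] at hg
  obtain ⟨i, hi, rfl⟩ := grey_mem_loopLabels_iff.1 hg
  have hl : 0 < w.length := i.zero_le.trans_lt hi
  have hloop : ∀ k, [1, 0] ++ₛ (periodic w).drop k ∈ loopLabels w := fun k =>
    grey_mem_loopLabels_iff.2 ⟨k % w.length, Nat.mod_lt _ hl, (periodic_drop_mod w k).symm⟩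
  -- If the tail `b z` were a shift of `w^∞`, the step from it up to `z` would be a step of the
  -- loop, and `y` would lie on the loop.
  have hcons : ∀ b k, [b] ++ₛ (periodic w).drop i = (periodic w).drop k →
      (periodic w).get k = b ∧ (periodic w).drop (k + 1) = (periodic w).drop i := by
    intro b k hk
    rw [drop_eq_cons (periodic w) k] at hk
    exact ⟨(congrFun hk 0).symm, (Stream'.cons_injective2 hk).2.symm⟩
  have hgrey : ∀ b, [1, 0] ++ₛ ([b] ++ₛ (periodic w).drop i) ∈ MulAction.orbit thompsonF x :=
    fun b => (start_mem_orbit_iff (.white 0) [b]).2 (grey_drop_mem h.grey_periodic_mem i)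
  rcases adj_grey hgz hadj with h1 | h1 | h1 | ⟨h0, h1⟩ | ⟨h0, h1⟩
  · exact .inl (exists_black_ray hx0 hx1 h1)
  · refine .inr (.inl ⟨h1, hangsAt_leftTreeAt h1, rootedIso_leftTreeAt h1 ?_⟩)
    refine notPeriodic_of_mem_orbit hx0 hx1 h (hgrey 1) fun k hk => hy ?_
    obtain ⟨hk1, hk2⟩ := hcons 1 k hk
    rw [h1, ← hk2]
    exact white_mem_loopLabels h.2.1.1 hk1
  · refine .inr (.inr ⟨h1, hangsAt_treeAt h1, rootedIso_rightTreeAt h1 ?_⟩)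
    refine notPeriodic_of_mem_orbit hx0 hx1 h (hgrey 0) fun k hk => hy ?_
    rw [h1, show [1, 0, 0] ++ₛ (periodic w).drop i = [1, 0] ++ₛ ([0] ++ₛ (periodic w).drop i)
      from rfl, hk]
    exact hloop k
  -- The last two kinds of neighbours lie on the step up from `10z`, which stays on the loop.
  · rw [h1, Stream'.drop_drop] at hy
    exact absurd (hloop _) hy
  · rw [h1, Stream'.drop_drop] at hy
    refine absurd (white_mem_loopLabels h.2.1.1 ?_) hy
    rw [Stream'.get_drop] at h0
    exact h0
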